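/- \textbf{Setting.} Let $1\le n$, $0\le p\le n$ be integers and let $\underline c,\overline c\in\mathbb R^n$ satisfy $0\le \underline c_i\le\overline c_i$ for all $i\in[n]$. The nominal SELECTION problem has the feasible set $\mathcal X_{\rm nom}=\{z\in\{0,1\}^n:\sum_i z_i=p\}$; the first-stage solutions are the $x\in\{0,1\}^n$, and the second-stage solutions for $x$ are $\mathcal X(x)=\{y\in\{0,1\}^n: x+y\le \mathbf 1,\ x+y\in\mathcal X_{\rm nom}\}$. Two-stage discrete budgeted uncertainty with budget $\Gamma=1$ and equal first- and second-stage cost bounds means $$\mathcal U_B=\Big\{c\in\mathbb R^n_+: c_i=\underline c_i+(\overline c_i-\underline c_i)\delta_i,\ \delta\in\{0,1\}^n,\ \sum_i\delta_i\le B\Big\},\quad \mathcal U=\mathcal U_1,\quad \mathcal U(c)=\mathcal U_{B(c)},\quad B(c)=1-\sum_{i}\frac{c_i-\underline c_i}{\overline c_i-\underline c_i},$$ where a summand with $\overline c_i=\underline c_i$ counts as $0$. The two-stage robust problem is $$\textsc{Rob}=\min_{x\in\{0,1\}^n}\ \max_{c\in\mathcal U}\ \min_{y\in\mathcal X(x)}\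 \max_{d\in\mathcal U(c)}\ c^tx+d^ty,\qquad \min\emptyset=\infty .$$ For $\pi^{(0)},\pi^{(1)}\ge 0$ let $\mathrm{Sub}(\pi^{(0)},\pi^{(1)})$ be the problem of minimizing $t$ over $t\in\mathbb R$, $x\in\{0,1\}^n$ and $y^{(0)},y^{(1)}\in\mathcal X(x)$ subject to $$t\ge \pi^{(0)}+\underline c^ty^{(0)}+\underline c^tx,\qquad t\ge \pi^{(1)}+\underline c^ty^{(1)}+\underline c^tx,$$ $y^{(0)}_i=0$ whenever $\overline c_i-\underline c_i>\pi^{(0)}$, and $x_i=0$ whenever $\overline c_i-\underline c_i>\pi^{(1)}$. Time is counted on a real RAM: a fixed finite program, with random access to arrays of natural numbers and of reals, in which each elementary instruction (copying, adding or subtracting two numbers of the same kind, loading a constant, where the only real constant is $0$, array access) and each test (comparison of two numbers of the same kind) costs one step. \textbf{Theorem.} (1) The two-stage robust problem above can be solved in $O(n^5)$ time: there are a program and a constant $C$ such that, for all $n,p,\underline c,\overline c$ as above, the program halts on input $(n,p,\underline c,\overline c)$ within $C n^5$ steps and outputs the value $\textsc{Rob}$ together with an optimal first-stage solution $x$. (2)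 The robust problem decomposes into $O(n^2)$ subproblems: with $\Pi=\{\overline c_i-\underline c_i:i\in[n]\}\cup\{0\}$, $$\textsc{Rob}=\min_{(\pi^{(0)},\pi^{(1)})\in\Pi\times\Pi}\ \text{(optimal value of }\mathrm{Sub}(\pi^{(0)},\pi^{(1)})\text{)},\qquad |\Pi\times\Pi|=O(n^2),$$ where an infeasible subproblem has the value $\infty$. (3) Each subproblem can be solved in $O(n^3)$ time: there are a program and a constant $C$ such that, for all $n,p,\underline c,\overline c$ as above and all $\pi^{(0)},\pi^{(1)}\ge 0$, the program halts within $C n^3$ steps and either outputs an optimal solution $(t,x,y^{(0)},y^{(1)})$ of $\mathrm{Sub}(\pi^{(0)},\pi^{(1)})$ or reports that it is infeasible. -/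

import Mathlib

namespace TwoStage

/-! ## The two-stage robust problem with two-stage uncertainty -/

section Problem

variable {n : ℕ}

/-- `x ∈ {0,1}ⁿ`. -/
def IsBinary (x : Fin n → ℝ) : Prop := ∀ i, x i = 0 ∨ x i = 1

/-- Feasible set of the nominal SELECTION problem: 0/1 vectors with exactly `p` ones. -/
def selection (n p : ℕ) : Set (Fin n → ℝ) :=
  {x | IsBinary x ∧ ∑ i, x i = (p : ℝ)}

/-- The feasible second-stage solutions `𝒳(x)` for a first-stage solution `x`. -/
def secondStage (nom : Set (Fin n → ℝ)) (x : Fin n → ℝ) : Set (Fin n → ℝ) :=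
  {y | IsBinary y ∧ (∀ i, x i + y i ≤ 1) ∧ x + y ∈ nom}

/-- Discrete budgeted uncertainty set: at most `B` items have their cost raised from the lower
bound `lo` to the upper bound `hi`. -/
def budgetSet (lo hi : Fin n → ℝ) (B : ℝ) : Set (Fin n → ℝ) :=
  {c | (∀ i, 0 ≤ c i) ∧ ∃ δ : Fin n → ℝ, IsBinary δ ∧ ∑ i, δ i ≤ B ∧
    ∀ i, c i = lo i + (hi i - lo i) * δ i}

/-- Budget already spent by the first-stage scenario `c`. A summand with `hi i = lo i` is
`0 / 0 = 0`: such an item cannot be raised, so it uses no budget. -/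
noncomputable def usedBudget (lo hi c : Fin n → ℝ) : ℝ :=
  ∑ i, (c i - lo i) / (hi i - lo i)

/-- The second-stage uncertainty set `𝒰(c)`: only the remaining budget can be used. -/
def secondUncertainty (clo chi dlo dhi : Fin n → ℝ) (Γ : ℝ) (c : Fin n → ℝ) :
    Set (Fin n → ℝ) :=
  budgetSet dlo dhi (Γ - usedBudget clo chi c)

/-- `max_{c ∈ 𝒰} min_{y ∈ 𝒳(x)} max_{d ∈ 𝒰(c)} cᵗx + dᵗy`, where `min ∅ = ∞`. -/
noncomputable def adv (nom : Set (Fin n → ℝ)) (clo chi dlo dhi : Fin n → ℝ) (Γ : ℝ)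
    (x : Fin n → ℝ) : EReal :=
  ⨆ c ∈ budgetSet clo chi Γ, ⨅ y ∈ secondStage nom x,
    ⨆ d ∈ secondUncertainty clo chi dlo dhi Γ c,
      ((∑ i, c i * x i + ∑ i, d i * y i : ℝ) : EReal)

/-- The optimal value of the two-stage robust problem with two-stage discrete budgeted
uncertainty: the minimum of `adv` over all first-stage solutions `x ∈ {0,1}ⁿ`. -/
noncomputable def rob (nom : Set (Fin n → ℝ)) (clo chi dlo dhi : Fin n → ℝ) (Γ : ℝ) : EReal :=
  ⨅ x ∈ {x : Fin n → ℝ | IsBinary x}, adv nom clo chi dlo dhi Γ x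

/-- Feasibility of `(t, x, y0, y1)` in the subproblem with fixed parameters `π0`, `π1`
(equal first- and second-stage cost bounds `lo`, `hi`, budget one); `t` is to be minimised. -/
def SubFeasible (nom : Set (Fin n → ℝ)) (lo hi : Fin n → ℝ) (π0 π1 : ℝ)
    (t : ℝ) (x y0 y1 : Fin n → ℝ) : Prop :=
  π0 + ∑ i, lo i * y0 i + ∑ i, lo i * x i ≤ t ∧
  π1 + ∑ i, lo i * y1 i + ∑ i, lo i * x i ≤ t ∧
  IsBinary x ∧ y0 ∈ secondStage nom x ∧ y1 ∈ secondStage nom x ∧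
  (∀ i, π0 < hi i - lo i → y0 i = 0) ∧
  (∀ i, π1 < hi i - lo i → x i = 0)

/-- Optimal value of the subproblem (`∞` if it is infeasible). -/
noncomputable def subValue (nom : Set (Fin n → ℝ)) (lo hi : Fin n → ℝ) (π0 π1 : ℝ) : EReal :=
  ⨅ t ∈ {t : ℝ | ∃ x y0 y1, SubFeasible nom lo hi π0 π1 t x y0 y1}, (t : EReal)

/-- Candidate values for `π0` and `π1`. -/
noncomputable def deviations (lo hi : Fin n → ℝ) : Finset ℝ :=
  insert 0 (Finset.univ.image fun i => hi i - lo i)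

end Problem

/-! ## The machine model: a real RAM with a step count

A machine has natural-number registers and arrays (for indices and counters) and real registers
and arrays (for costs). A program is a finite structured program over elementary instructions;
every elementary instruction and every evaluation of a test costs one step. Reals can only be
copied, added, subtracted and compared; the only real constant is `0`; reals and naturals cannot
be converted into each other. -/

/-- Memory contents: registers and arrays are numbered by naturals, array cells too. -/
structure Memory where
  nreg : ℕ → ℕ
  narr : ℕ → ℕ → ℕ
  rreg : ℕ → ℝ
  rarr : ℕ → ℕ → ℝ

/-- Elementary instructions; the first argument is the destination. -/
inductive Instr where
  /-- no operation -/
  | skip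
  /-- `N[dst] := k` -/
  | nconst (dst k : ℕ)
  /-- `N[dst] := N[a]` -/
  | ncopy (dst a : ℕ)
  /-- `N[dst] := N[a] + N[b]` -/
  | nadd (dst a b : ℕ)
  /-- `N[dst] := N[a] - N[b]`, truncated at zero -/
  | nsub (dst a b : ℕ)
  /-- `N[dst] := A[N[i]]` for the natural array number `arr` -/
  | nload (dst arr i : ℕ)
  /-- `A[N[i]] := N[a]` for the natural array number `arr` -/
  | nstore (arr i a : ℕ)
  /-- `R[dst] := 0` -/
  | rzero (dst : ℕ)
  /-- `R[dst] := R[a]` -/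
  | rcopy (dst a : ℕ)
  /-- `R[dst] := R[a] + R[b]` -/
  | radd (dst a b : ℕ)
  /-- `R[dst] := R[a] - R[b]` -/
  | rsub (dst a b : ℕ)
  /-- `R[dst] := A[N[i]]` for the real array number `arr` -/
  | rload (dst arr i : ℕ)
  /-- `A[N[i]] := R[a]` for the real array number `arr` -/
  | rstore (arr i a : ℕ)

open Function in
/-- Effect of an elementary instruction. -/
noncomputable def Instr.exec : Instr → Memory → Memory
  | .skip, s => s
  | .nconst dst k, s => { s with nreg := update s.nreg dst k }
  | .ncopy dst a, s => { s with nreg := update s.nreg dst (s.nreg a) }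
  | .nadd dst a b, s => { s with nreg := update s.nreg dst (s.nreg a + s.nreg b) }
  | .nsub dst a b, s => { s with nreg := update s.nreg dst (s.nreg a - s.nreg b) }
  | .nload dst arr i, s => { s with nreg := update s.nreg dst (s.narr arr (s.nreg i)) }
  | .nstore arr i a, s =>
      { s with narr := update s.narr arr (update (s.narr arr) (s.nreg i) (s.nreg a)) }
  | .rzero dst, s => { s with rreg := update s.rreg dst 0 }
  | .rcopy dst a, s => { s with rreg := update s.rreg dst (s.rreg a) }
  | .radd dst a b, s => { s with rreg := update s.rreg dst (s.rreg a + s.rreg b) }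
  | .rsub dst a b, s => { s with rreg := update s.rreg dst (s.rreg a - s.rreg b) }
  | .rload dst arr i, s => { s with rreg := update s.rreg dst (s.rarr arr (s.nreg i)) }
  | .rstore arr i a, s =>
      { s with rarr := update s.rarr arr (update (s.rarr arr) (s.nreg i) (s.rreg a)) }

/-- Tests: comparison of two registers of the same kind. -/
inductive Test where
  | nlt (a b : ℕ)
  | neq (a b : ℕ)
  | rlt (a b : ℕ)
  | rle (a b : ℕ)

/-- Truth of a test in a memory. -/
def Test.Holds : Test → Memory → Prop
  | .nlt a b, s => s.nreg a < s.nreg b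
  | .neq a b, s => s.nreg a = s.nreg b
  | .rlt a b, s => s.rreg a < s.rreg b
  | .rle a b, s => s.rreg a ≤ s.rreg b

/-- Programs. -/
inductive Program where
  | instr (e : Instr)
  | seq (P Q : Program)
  | cond (b : Test) (P Q : Program)
  | loop (b : Test) (P : Program)

/-- `P.Runs s k s'`: started in memory `s`, the program `P` halts after exactly `k` steps, and
the final memory is `s'`. -/
inductive Program.Runs : Program → Memory → ℕ → Memory → Prop where
  | instr (e : Instr) (s : Memory) : Runs (.instr e) s 1 (e.exec s)
  | seq {P Q : Program} {s s' s'' : Memory} {k l : ℕ} :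
      Runs P s k s' → Runs Q s' l s'' → Runs (.seq P Q) s (k + l) s''
  | cond_true {b : Test} {P Q : Program} {s s' : Memory} {k : ℕ} :
      b.Holds s → Runs P s k s' → Runs (.cond b P Q) s (k + 1) s'
  | cond_false {b : Test} {P Q : Program} {s s' : Memory} {k : ℕ} :
      ¬ b.Holds s → Runs Q s k s' → Runs (.cond b P Q) s (k + 1) s'
  | loop_done {b : Test} {P : Program} {s : Memory} :
      ¬ b.Holds s → Runs (.loop b P) s 1 s
  | loop_step {b : Test} {P : Program} {s s' s'' : Memory} {k l : ℕ} :
      b.Holds s → Runs P s k s' → Runs (.loop b P) s' l s'' →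
        Runs (.loop b P) s (k + l + 1) s''

/-! ## Input and output -/

/-- A vector as the contents of an array (zero beyond its length). -/
def toArray {n : ℕ} (v : Fin n → ℝ) : ℕ → ℝ := fun i => if h : i < n then v ⟨i, h⟩ else 0

/-- Input memory: `n`, `p` in the natural registers `0`, `1`; `r0`, `r1` in the real registers
`0`, `1`; the cost bounds `lo`, `hi` in the real arrays `0`, `1`; all else is zero. -/
def input {n : ℕ} (p : ℕ) (lo hi : Fin n → ℝ) (r0 r1 : ℝ) : Memory where
  nreg := fun k => if k = 0 then n else if k = 1 then p else 0
  narr := fun _ _ => 0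
  rreg := fun k => if k = 0 then r0 else if k = 1 then r1 else 0
  rarr := fun k => if k = 0 then toArray lo else if k = 1 then toArray hi else fun _ => 0

/-- The vector of length `n` in the natural array number `arr`. -/
def output (s : Memory) (n arr : ℕ) : Fin n → ℝ := fun i => (s.narr arr i : ℝ)

/-- The final memory holds an optimal first-stage solution (natural array `0`) and the optimal
value (real register `0`) of the two-stage robust selection problem with `Γ = 1` and equal first-
and second-stage cost bounds. -/
def SolvesRob {n : ℕ} (p : ℕ) (lo hi : Fin n → ℝ) (s : Memory) : Prop :=
  IsBinary (output s n 0) ∧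
  adv (selection n p) lo hi lo hi 1 (output s n 0) = rob (selection n p) lo hi lo hi 1 ∧
  rob (selection n p) lo hi lo hi 1 = (s.rreg 0 : EReal)

/-- Either natural register `0` holds `1`, and real register `0` and the natural arrays `0, 1, 2`
hold an optimal solution `(t, x, y0, y1)` of the subproblem, or natural register `0` holds `0`
and the subproblem is infeasible. -/
def SolvesSub {n : ℕ} (p : ℕ) (lo hi : Fin n → ℝ) (π0 π1 : ℝ) (s : Memory) : Prop :=
  (s.nreg 0 = 1 ∧
    SubFeasible (selection n p) lo hi π0 π1 (s.rreg 0) (output s n 0) (output s n 1)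
      (output s n 2) ∧
    ∀ t x y0 y1, SubFeasible (selection n p) lo hi π0 π1 t x y0 y1 → s.rreg 0 ≤ t) ∨
  (s.nreg 0 = 0 ∧
    ∀ t x y0 y1, ¬ SubFeasible (selection n p) lo hi π0 π1 t x y0 y1)

end TwoStage

open TwoStage

/-!
With budget one, the adversary raises at most one cost, in the first or in the second stage. Hence
the value of a first-stage solution `x` is the larger of two numbers: `loᵗx` plus the least value
of `loᵗy` plus the largest deviation `hi i - lo i` in `y` (nothing is raised in the first stage),
and `loᵗx` plus the largest deviation in `x` plus the least value of `loᵗy` (an item of `x` is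
raised). Guessing the two largest deviations `π0`, `π1` gives the decomposition
`rob_eq_iInf_subValue`; its two halves are `adv_le_of_subFeasible` and
`exists_subFeasible_le_adv`.

In the subproblem for `(π0, π1)`, let `F` be the set of the items with deviation at most `π0`, and
`C` the set of the other items with deviation at most `π1`. An item of `x` that lies in `F` may be
moved to both `y0` and `y1` without any change of cost, so `x` may be assumed to lie in `C`. For a
given size `k` of `x`, an exchange argument (`exists_cheapest_le`) shows that it is optimal to let
`x` consist of the `k` cheapest items of `C`, `y0` of the `p - k` cheapest items of `F`, and `y1` of
the `p - k` cheapest items outside `x`. So `n + 1` candidate solutions have to be compared. The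
cheapest items of a set are those before which there are few others, and counting these takes
`O(n²)` steps, which gives `O(n³)` steps for a subproblem and `O(n⁵)` for the robust problem.

The programs are written in a language `FProg` with counting loops only, for which the final memory
is a function `FProg.den` of the initial one and `FProg.exists_runs` bounds the number of steps by a
constant times `M ^ d`, where `M` bounds the loop lengths and `d` is the nesting depth of the loops.
Thus the programs are verified in terms of `FProg.den` alone, with the invariant rule
`FProg.den_rep_induct`, and their running times follow from a syntactic check.
-/

namespace TwoStage

/-! ### Decomposition into subproblems -/

section Decomposition

variable {n : ℕ} {nom : Set (Fin n → ℝ)} {lo hi : Fin n → ℝ}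

theorem IsBinary.nonneg {x : Fin n → ℝ} (hx : IsBinary x) (i : Fin n) : 0 ≤ x i := by
  rcases hx i with h | h <;> simp [h]

theorem finite_isBinary : {x : Fin n → ℝ | IsBinary x}.Finite := by
  have : (Set.pi Set.univ fun _ : Fin n => ({0, 1} : Set ℝ)).Finite :=
    Set.Finite.pi fun _ => Set.toFinite _
  exact this.subset fun x hx i _ => by simpa using hx i

/-- If only items with deviation at most `π` are used, then one raised cost adds at most `π`. -/
theorem sum_raised_mul_le {z δ : Fin n → ℝ} {π : ℝ} (hz : IsBinary z) (hδ : IsBinary δ)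
    (hsum : ∑ i, δ i ≤ 1) (hπ : 0 ≤ π) (h : ∀ i, π < hi i - lo i → z i = 0) :
    ∑ i, (lo i + (hi i - lo i) * δ i) * z i ≤ π + ∑ i, lo i * z i := by
  have h1 : ∑ i, (lo i + (hi i - lo i) * δ i) * z i
      ≤ ∑ i, (π * δ i + lo i * z i) := by
    refine Finset.sum_le_sum fun i _ => ?_
    have hd : (hi i - lo i) * z i ≤ π := by
      rcases hz i with h0 | h1
      · simp [h0, hπ]
      · have : ¬ π < hi i - lo i := fun hlt => by simp [h i hlt] at h1
        rw [h1]; linarith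
    nlinarith [mul_le_mul_of_nonneg_right hd (hδ.nonneg i)]
  rw [Finset.sum_add_distrib, ← Finset.mul_sum] at h1
  nlinarith

theorem lo_mem_budgetSet (hlo : ∀ i, 0 ≤ lo i) {B : ℝ} (hB : 0 ≤ B) : lo ∈ budgetSet lo hi B :=
  ⟨hlo, fun _ => 0, fun _ => Or.inl rfl, by simpa, by simp⟩

/-- The scenario in which exactly the cost of item `j` is raised. -/
theorem raise_mem_budgetSet (hlo : ∀ i, 0 ≤ lo i ∧ lo i ≤ hi i) (j : Fin n) :
    (fun i => lo i + (hi i - lo i) * (Pi.single j 1 : Fin n → ℝ) i) ∈ budgetSet lo hi 1 := by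
  classical
  have hb : IsBinary (Pi.single j 1 : Fin n → ℝ) := fun i => by
    by_cases h : i = j
    · subst h; simp
    · simp [h]
  refine ⟨fun i => ?_, Pi.single j 1, hb, by simp, fun i => rfl⟩
  have := hlo i
  have := mul_nonneg (sub_nonneg.2 this.2) (hb.nonneg i)
  linarith [(hlo i).1]

@[simp] theorem usedBudget_lo : usedBudget lo hi lo = 0 := by simp [usedBudget]

theorem usedBudget_raise {j : Fin n} (hj : lo j < hi j) :
    usedBudget lo hi (fun i => lo i + (hi i - lo i) * (Pi.single j 1 : Fin n → ℝ) i) = 1 := by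
  classical
  rw [usedBudget, Finset.sum_eq_single j]
  · have : hi j - lo j ≠ 0 := by linarith
    simp [this]
  · intro i _ hij; simp [hij]
  · simp

/-- If an item of positive deviation is raised in the first stage, then `y1` is a good answer, and
otherwise `y0` is. -/
theorem adv_le_of_subFeasible (hlo : ∀ i, 0 ≤ lo i ∧ lo i ≤ hi i) {π0 π1 t : ℝ}
    {x y0 y1 : Fin n → ℝ} (h0 : 0 ≤ π0) (h1 : 0 ≤ π1)
    (h : SubFeasible nom lo hi π0 π1 t x y0 y1) : adv nom lo hi lo hi 1 x ≤ t := by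
  obtain ⟨ht0, ht1, hx, hy0, hy1, hc0, hc1⟩ := h
  refine iSup₂_le fun c hc => ?_
  obtain ⟨-, δ, hδ, hsum, hcδ⟩ := hc
  by_cases hraise : ∃ j, δ j = 1 ∧ lo j < hi j
  · -- the budget is spent in the first stage, so the second-stage costs are `lo`: answer by `y1`
    refine iInf₂_le_of_le y1 hy1 (iSup₂_le fun d hd => ?_)
    obtain ⟨-, ε, hε, hεsum, hdε⟩ := hd
    obtain ⟨j, hj, hlt⟩ := hraise
    have hu : 1 ≤ usedBudget lo hi c := by
      have hterm : ∀ i, 0 ≤ (c i - lo i) / (hi i - lo i) := fun i => by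
        have := sub_nonneg.2 (hlo i).2
        rw [hcδ i]
        exact div_nonneg (by nlinarith [hδ.nonneg i]) this
      refine le_trans (le_of_eq ?_)
        (Finset.single_le_sum (fun i _ => hterm i) (Finset.mem_univ j))
      have : hi j - lo j ≠ 0 := by linarith
      rw [hcδ j, hj]; field_simp; ring
    have hε0 : ∀ i, ε i = 0 := fun i => by
      have h1 := Finset.single_le_sum (f := ε) (fun i _ => hε.nonneg i) (Finset.mem_univ i)
      have := hε.nonneg i
      linarith
    have hd : ∑ i, d i * y1 i = ∑ i, lo i * y1 i := by simp [hdε, hε0]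
    have hc : ∑ i, c i * x i ≤ π1 + ∑ i, lo i * x i := by
      simp only [hcδ]; exact sum_raised_mul_le hx hδ hsum h1 hc1
    exact_mod_cast (by linarith : ∑ i, c i * x i + ∑ i, d i * y1 i ≤ t)
  · -- no first-stage cost is raised: answer by `y0`
    refine iInf₂_le_of_le y0 hy0 (iSup₂_le fun d hd => ?_)
    have hclo : c = lo := by
      funext i
      rcases hδ i with h | h
      · simp [hcδ, h]
      · have : hi i = lo i := le_antisymm (not_lt.1 fun hl => hraise ⟨i, h, hl⟩) (hlo i).2
        simp [hcδ, this]
    subst hclo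
    obtain ⟨-, ε, hε, hεsum, hdε⟩ := hd
    rw [usedBudget_lo, sub_zero] at hεsum
    have hd : ∑ i, d i * y0 i ≤ π0 + ∑ i, c i * y0 i := by
      simp only [hdε]; exact sum_raised_mul_le hy0.1 hε hεsum h0 hc0
    exact_mod_cast (by linarith : ∑ i, c i * x i + ∑ i, d i * y0 i ≤ t)

/-- The largest deviation among the items used by `z`, or zero. -/
theorem exists_max_deviation (lo hi z : Fin n → ℝ) :
    ∃ π ∈ deviations lo hi, 0 ≤ π ∧ (∀ i, z i = 1 → hi i - lo i ≤ π) ∧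
      (π = 0 ∨ ∃ j, z j = 1 ∧ lo j < hi j ∧ π = hi j - lo j) := by
  classical
  by_cases hne : (Finset.univ.filter fun i => z i = 1 ∧ lo i < hi i).Nonempty
  · obtain ⟨j, hj, hmax⟩ := Finset.exists_max_image _ (fun i => hi i - lo i) hne
    simp only [Finset.mem_filter, Finset.mem_univ, true_and] at hj hmax
    refine ⟨hi j - lo j, by simp [deviations], by linarith [hj.2], fun i hi1 => ?_,
      Or.inr ⟨j, hj.1, hj.2, rfl⟩⟩
    by_cases hl : lo i < hi i
    · exact hmax i ⟨hi1, hl⟩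
    · linarith [hj.2]
  · refine ⟨0, by simp [deviations], le_rfl, fun i hi1 => ?_, Or.inl rfl⟩
    by_contra hl
    exact hne ⟨i, by simp only [Finset.mem_filter, Finset.mem_univ, true_and]
                     exact ⟨hi1, by linarith⟩⟩

theorem sum_raise_mul {z : Fin n → ℝ} {j : Fin n} (hj : z j = 1) :
    ∑ i, (lo i + (hi i - lo i) * (Pi.single j 1 : Fin n → ℝ) i) * z i
      = hi j - lo j + ∑ i, lo i * z i := by
  classical
  simp only [add_mul, Finset.sum_add_distrib]
  rw [add_comm, Finset.sum_eq_single j]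
  · simp [hj]
  · intro i _ hij; simp [hij]
  · simp

/-- The parameters are the largest deviations in `y0` and in `x`, where `y0` and `y1` are optimal
answers if the budget is available and if it is spent, respectively. -/
theorem exists_subFeasible_le_adv (hlo : ∀ i, 0 ≤ lo i ∧ lo i ≤ hi i) {x : Fin n → ℝ}
    (hx : IsBinary x) (hne : (secondStage nom x).Nonempty) :
    ∃ π0 ∈ deviations lo hi, ∃ π1 ∈ deviations lo hi, ∃ t y0 y1,
      SubFeasible nom lo hi π0 π1 t x y0 y1 ∧ (t : EReal) ≤ adv nom lo hi lo hi 1 x := by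
  have hlo0 : ∀ i, 0 ≤ lo i := fun i => (hlo i).1
  choose M hM hM0 hMle hMeq using exists_max_deviation lo hi
  have hfin : (secondStage nom x).Finite := finite_isBinary.subset fun y hy => hy.1
  obtain ⟨y0, hy0, hmin0⟩ := Set.exists_min_image _ (fun y => M y + ∑ i, lo i * y i) hfin hne
  obtain ⟨y1, hy1, hmin1⟩ := Set.exists_min_image _ (fun y => ∑ i, lo i * y i) hfin hne
  have hzero : ∀ z : Fin n → ℝ, IsBinary z → ∀ i, M z < hi i - lo i → z i = 0 := by
    intro z hz i hlt
    rcases hz i with h | h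
    · exact h
    · exact absurd (hMle z i h) (not_le.2 hlt)
  refine ⟨M y0, hM y0, M x, hM x,
    max (M y0 + ∑ i, lo i * y0 i + ∑ i, lo i * x i) (M x + ∑ i, lo i * y1 i + ∑ i, lo i * x i),
    y0, y1, ⟨le_max_left _ _, le_max_right _ _, hx, hy0, hy1, hzero y0 hy0.1, hzero x hx⟩, ?_⟩
  have hU : lo ∈ secondUncertainty lo hi lo hi 1 lo :=
    lo_mem_budgetSet hlo0 (by simp)
  rw [EReal.coe_strictMono.monotone.map_max]
  refine max_le ?_ ?_
  · refine le_iSup₂_of_le lo (lo_mem_budgetSet hlo0 zero_le_one) (le_iInf₂ fun y hy => ?_)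
    have hm := hmin0 y hy
    rcases hMeq y with h | ⟨j, hj, hlt, h⟩
    · refine le_iSup₂_of_le lo hU ?_
      exact_mod_cast (by simp only [h] at hm; linarith)
    · refine le_iSup₂_of_le
        (fun i => lo i + (hi i - lo i) * (Pi.single j 1 : Fin n → ℝ) i) ?_ ?_
      · rw [secondUncertainty, usedBudget_lo, sub_zero]
        exact raise_mem_budgetSet hlo j
      · rw [sum_raise_mul hj]
        exact_mod_cast (by simp only [h] at hm; linarith)
  · rcases hMeq x with h | ⟨j, hj, hlt, h⟩
    · refine le_iSup₂_of_le lo (lo_mem_budgetSet hlo0 zero_le_one) (le_iInf₂ fun y hy => ?_)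
      have hm := hmin1 y hy
      refine le_iSup₂_of_le lo hU ?_
      exact_mod_cast (by linarith)
    · refine le_iSup₂_of_le _ (raise_mem_budgetSet hlo j) (le_iInf₂ fun y hy => ?_)
      have hm := hmin1 y hy
      refine le_iSup₂_of_le lo ?_ ?_
      · rw [secondUncertainty, usedBudget_raise hlt, sub_self]
        exact lo_mem_budgetSet hlo0 le_rfl
      · rw [sum_raise_mul hj]
        exact_mod_cast (by linarith)

theorem nonneg_of_mem_deviations (hlo : ∀ i, 0 ≤ lo i ∧ lo i ≤ hi i) {π : ℝ}
    (h : π ∈ deviations lo hi) : 0 ≤ π := by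
  simp only [deviations, Finset.mem_insert, Finset.mem_image, Finset.mem_univ, true_and] at h
  rcases h with rfl | ⟨i, rfl⟩
  · exact le_rfl
  · linarith [(hlo i).2]

theorem card_deviations_le : (deviations lo hi).card ≤ n + 1 :=
  (Finset.card_insert_le _ _).trans
    (Nat.add_le_add_right (Finset.card_image_le.trans (by simp)) 1)

/-- Without a second-stage completion, the value of a first-stage solution is infinite. -/
theorem adv_eq_top (hlo : ∀ i, 0 ≤ lo i) {x : Fin n → ℝ}
    (h : ¬ (secondStage nom x).Nonempty) : adv nom lo hi lo hi 1 x = ⊤ := by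
  rw [Set.not_nonempty_iff_eq_empty] at h
  refine top_le_iff.1 (le_iSup₂_of_le lo (lo_mem_budgetSet hlo zero_le_one) ?_)
  simp [h]

theorem rob_eq_iInf_subValue (hlo : ∀ i, 0 ≤ lo i ∧ lo i ≤ hi i) :
    rob nom lo hi lo hi 1 =
      ⨅ q ∈ deviations lo hi ×ˢ deviations lo hi, subValue nom lo hi q.1 q.2 := by
  refine le_antisymm (le_iInf₂ fun q hq => le_iInf₂ fun t ht => ?_) (le_iInf₂ fun x hx => ?_)
  · obtain ⟨x, y0, y1, h⟩ := ht
    rw [Finset.mem_product] at hq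
    exact iInf₂_le_of_le x h.2.2.1 (adv_le_of_subFeasible hlo
      (nonneg_of_mem_deviations hlo hq.1) (nonneg_of_mem_deviations hlo hq.2) h)
  · by_cases hne : (secondStage nom x).Nonempty
    · obtain ⟨π0, h0, π1, h1, t, y0, y1, h, ht⟩ := exists_subFeasible_le_adv hlo hx hne
      exact (iInf₂_le_of_le (π0, π1) (Finset.mk_mem_product h0 h1)
        (iInf₂_le_of_le t ⟨x, y0, y1, h⟩ le_rfl)).trans ht
    · rw [adv_eq_top (fun i => (hlo i).1) hne]; exact le_top

end Decomposition

/-! ### Cheapest subsets -/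

section Cheapest

open Finset

variable {w : ℕ → ℝ} {S : Finset ℕ}

/-- Strict order of the items by weight, with ties broken by the index. -/
def Before (w : ℕ → ℝ) (j i : ℕ) : Prop := w j < w i ∨ w j ≤ w i ∧ j < i

theorem Before.irrefl (i : ℕ) : ¬ Before w i i := by simp [Before]

theorem Before.trans {i j k : ℕ} (h : Before w i j) (h' : Before w j k) : Before w i k := by
  rcases h with h | h <;> rcases h' with h' | h'
  · exact Or.inl (h.trans h')
  · exact Or.inl (h.trans_le h'.1)
  · exact Or.inl (h.1.trans_lt h')
  · exact Or.inr ⟨h.1.trans h'.1, h.2.trans h'.2⟩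

theorem Before.total {i j : ℕ} (h : i ≠ j) : Before w i j ∨ Before w j i := by
  rcases lt_trichotomy (w i) (w j) with h1 | h1 | h1
  · exact Or.inl (Or.inl h1)
  · rcases lt_or_gt_of_ne h with h2 | h2
    · exact Or.inl (Or.inr ⟨h1.le, h2⟩)
    · exact Or.inr (Or.inr ⟨h1.ge, h2⟩)
  · exact Or.inr (Or.inl h1)

open Classical in
/-- The number of elements of `S` that come before `i`. -/
noncomputable def rank (w : ℕ → ℝ) (S : Finset ℕ) (i : ℕ) : ℕ := #{j ∈ S | Before w j i}

/-- The `q` cheapest elements of `S`, or all of `S` if there are fewer. -/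
noncomputable def cheapest (w : ℕ → ℝ) (S : Finset ℕ) (q : ℕ) : Finset ℕ :=
  {i ∈ S | rank w S i < q}

theorem rank_lt_rank {i j : ℕ} (hi : i ∈ S) (h : Before w i j) : rank w S i < rank w S j := by
  classical
  refine card_lt_card ⟨fun k hk => ?_, fun hsub => ?_⟩
  · rw [mem_filter] at hk ⊢
    exact ⟨hk.1, hk.2.trans h⟩
  · exact Before.irrefl i (mem_filter.1 (hsub (mem_filter.2 ⟨hi, h⟩))).2

theorem rank_injOn : Set.InjOn (rank w S) S := by
  intro i hi j hj h
  by_contra hne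
  rcases Before.total (w := w) hne with h' | h'
  · exact (rank_lt_rank hi h').ne h
  · exact (rank_lt_rank hj h').ne h.symm

theorem rank_lt_card {i : ℕ} (hi : i ∈ S) : rank w S i < #S := by
  classical
  refine card_lt_card ⟨filter_subset _ _, fun hsub => ?_⟩
  exact Before.irrefl i (mem_filter.1 (hsub hi)).2

theorem image_rank : S.image (rank w S) = range #S := by
  refine eq_of_subset_of_card_le (fun r hr => ?_) ?_
  · obtain ⟨i, hi, rfl⟩ := mem_image.1 hr
    exact mem_range.2 (rank_lt_card hi)
  · rw [card_range, card_image_of_injOn rank_injOn]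

theorem cheapest_subset (q : ℕ) : cheapest w S q ⊆ S := filter_subset _ _

theorem cheapest_mono {q r : ℕ} (h : q ≤ r) : cheapest w S q ⊆ cheapest w S r := fun i hi => by
  rw [cheapest, mem_filter] at hi ⊢
  exact ⟨hi.1, hi.2.trans_le h⟩

theorem card_cheapest (q : ℕ) : #(cheapest w S q) = min q #S := by
  have himg : (cheapest w S q).image (rank w S) = range (min q #S) := by
    ext r
    have hr := congrArg (r ∈ ·) (image_rank (w := w) (S := S))
    simp only [mem_image, mem_range, eq_iff_iff] at hr
    simp only [cheapest, mem_image, mem_filter, mem_range, lt_min_iff, ← hr]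
    constructor
    · rintro ⟨i, ⟨hi, hq⟩, rfl⟩; exact ⟨hq, i, hi, rfl⟩
    · rintro ⟨hq, i, hi, rfl⟩; exact ⟨i, ⟨hi, hq⟩, rfl⟩
  rw [← card_range (min q #S), ← himg,
    card_image_of_injOn (rank_injOn.mono (coe_subset.2 (cheapest_subset q)))]

theorem sum_cheapest_le {R : Finset ℕ} (hR : R ⊆ S) :
    ∑ i ∈ cheapest w S #R, w i ≤ ∑ i ∈ R, w i := by
  set T := cheapest w S #R with hT
  have hcard : #T = #R := by rw [hT, card_cheapest, min_eq_left (card_le_card hR)]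
  have hle : ∀ i ∈ T \ R, ∀ j ∈ R \ T, w i ≤ w j := by
    intro i hi j hj
    rw [mem_sdiff] at hi hj
    by_contra hlt
    have h1 := rank_lt_rank (hR hj.1) (Or.inl (not_le.1 hlt))
    have h2 := (mem_filter.1 hi.1).2
    exact hj.2 (mem_filter.2 ⟨hR hj.1, h1.trans h2⟩)
  have hc : #(T \ R) = #(R \ T) := card_sdiff_comm hcard
  have hsum : ∑ i ∈ T \ R, w i ≤ ∑ i ∈ R \ T, w i := by
    rcases (R \ T).eq_empty_or_nonempty with he | hne
    · rw [he, card_empty, card_eq_zero] at hc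
      rw [he, hc]
    · obtain ⟨j, hj, hmin⟩ := exists_min_image _ w hne
      calc ∑ i ∈ T \ R, w i ≤ #(T \ R) • w j := sum_le_card_nsmul _ _ _ fun i hi => hle i hi j hj
        _ = #(R \ T) • w j := by rw [hc]
        _ ≤ ∑ i ∈ R \ T, w i := card_nsmul_le_sum _ _ _ hmin
  have h1 := sum_inter_add_sum_sdiff T R w
  have h2 := sum_inter_add_sum_sdiff R T w
  rw [inter_comm] at h2
  linarith

end Cheapest

/-! ### Optimal solutions of a subproblem -/

section Enumeration

open Finset

/-- It suffices to consider, for each `k`, the `k` cheapest elements of `C` as the first-stage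
solution, and the cheapest completions. Here `F` is the set of the items allowed for `Y0`, and `C`
consists of the items outside `F` that are allowed for `X`. -/
theorem exists_cheapest_le {w : ℕ → ℝ} {V C F X Y0 Y1 : Finset ℕ} {p : ℕ}
    (hC : C ⊆ V) (hX : X ⊆ C ∪ F) (hY0 : Y0 ⊆ F) (hXV : X ⊆ V) (hY1 : Y1 ⊆ V)
    (hd0 : Disjoint X Y0) (hd1 : Disjoint X Y1) (hc0 : #X + #Y0 = p) (hc1 : #X + #Y1 = p) :
    ∃ k ≤ p, #(cheapest w C k) + #(cheapest w F (p - k)) = p ∧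
      ∑ i ∈ cheapest w C k, w i + ∑ i ∈ cheapest w F (p - k), w i
        ≤ ∑ i ∈ X, w i + ∑ i ∈ Y0, w i ∧
      ∑ i ∈ cheapest w C k, w i + ∑ i ∈ cheapest w (V \ cheapest w C k) (p - k), w i
        ≤ ∑ i ∈ X, w i + ∑ i ∈ Y1, w i := by
  -- the elements of `X ∩ F` may be moved to `Y0` and `Y1`
  set X' := X \ F with hX'
  have hX'C : X' ⊆ C := fun i hi => by
    rw [hX', mem_sdiff] at hi
    exact (mem_union.1 (hX hi.1)).resolve_right hi.2
  have hkp : #X' ≤ p := (card_le_card sdiff_subset).trans (by omega)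
  have hck : #(cheapest w C #X') = #X' := by
    rw [card_cheapest, min_eq_left (card_le_card hX'C)]
  have hsplit : ∀ Y, Disjoint X Y → #X + #Y = p → #((X ∪ Y) \ X') = p - #X' ∧
      ∑ i ∈ X', w i + ∑ i ∈ (X ∪ Y) \ X', w i = ∑ i ∈ X, w i + ∑ i ∈ Y, w i := by
    intro Y hd hc
    have hsub : X' ⊆ X ∪ Y := sdiff_subset.trans subset_union_left
    constructor
    · rw [card_sdiff_of_subset hsub, card_union_of_disjoint hd, hc]
    · rw [add_comm, sum_sdiff hsub, sum_union hd]
  obtain ⟨hW, hWs⟩ := hsplit Y0 hd0 hc0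
  have hWF : (X ∪ Y0) \ X' ⊆ F := fun i hi => by
    rw [mem_sdiff, mem_union] at hi
    rcases hi.1 with h | h
    · by_contra hF
      exact hi.2 (mem_sdiff.2 ⟨h, hF⟩)
    · exact hY0 h
  have h1 := sum_cheapest_le (w := w) hX'C
  refine ⟨#X', hkp, ?_, ?_, ?_⟩
  · have := card_le_card hWF
    rw [hck, card_cheapest, min_eq_left (by omega)]
    omega
  · have h2 := sum_cheapest_le (w := w) hWF
    rw [hW] at h2
    linarith
  · -- in `U = X ∪ Y1`, exchange `U ∩ C` for the cheapest elements of `C`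
    set U := X ∪ Y1 with hU
    set T := cheapest w C #(U ∩ C) with hT
    have hTk : cheapest w C #X' ⊆ T := cheapest_mono (card_le_card fun i hi =>
      mem_inter.2 ⟨mem_union_left _ (sdiff_subset hi), hX'C hi⟩)
    have hdisj : Disjoint T (U \ C) :=
      disjoint_of_subset_left (cheapest_subset _) disjoint_sdiff
    have hTc : #T = #(U ∩ C) := by
      rw [hT, card_cheapest, min_eq_left (card_le_card inter_subset_right)]
    have hUc : #(T ∪ U \ C) = p := by
      rw [card_union_of_disjoint hdisj, hTc, card_inter_add_card_sdiff, hU,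
        card_union_of_disjoint hd1, hc1]
    have hsub : cheapest w C #X' ⊆ T ∪ U \ C := hTk.trans subset_union_left
    have hR : (T ∪ U \ C) \ cheapest w C #X' ⊆ V \ cheapest w C #X' := by
      refine sdiff_subset_sdiff (union_subset ((cheapest_subset _).trans hC) ?_) le_rfl
      exact sdiff_subset.trans (union_subset hXV hY1)
    have h2 := sum_cheapest_le (w := w) hR
    rw [card_sdiff_of_subset hsub, hUc, hck] at h2
    have h3 := sum_sdiff hsub (f := w)
    rw [sum_union hdisj] at h3
    have h4 := sum_cheapest_le (w := w) (inter_subset_right : U ∩ C ⊆ C)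
    have h5 := sum_inter_add_sum_sdiff U C w
    have h6 : ∑ i ∈ U, w i = ∑ i ∈ X, w i + ∑ i ∈ Y1, w i := sum_union hd1
    linarith

end Enumeration

/-! ### Structured programs with counting loops -/

/-- Programs whose only loops are counting loops: `rep i lim P` runs `P` for the values
`0, 1, …, N[lim] - 1` of the natural register `i`. -/
inductive FProg where
  | instr (e : Instr)
  | seq (P Q : FProg)
  | cond (b : Test) (P Q : FProg)
  | rep (i lim : ℕ) (P : FProg)

instance : Coe Instr FProg := ⟨.instr⟩

namespace FProg

/-- Sequential composition of a list of programs. -/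
def block : List FProg → FProg
  | [] => Instr.skip
  | P :: Ps => seq P (block Ps)

/-- The program of the machine model; the natural register `9` is reserved for incrementing loop
counters. -/
def compile : FProg → Program
  | instr e => .instr e
  | seq P Q => .seq P.compile Q.compile
  | cond b P Q => .cond b P.compile Q.compile
  | rep i lim P => .seq (.instr (.nconst i 0)) (.loop (.nlt i lim)
      (.seq P.compile (.seq (.instr (.nconst 9 1)) (.instr (.nadd i i 9)))))

end FProg

/-- Effect of incrementing the loop counter `i`. -/
noncomputable def advance (i : ℕ) (s : Memory) : Memory :=
  (Instr.nadd i i 9).exec ((Instr.nconst 9 1).exec s)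

@[simp] theorem advance_narr (i : ℕ) (s : Memory) : (advance i s).narr = s.narr := rfl
@[simp] theorem advance_rreg (i : ℕ) (s : Memory) : (advance i s).rreg = s.rreg := rfl
@[simp] theorem advance_rarr (i : ℕ) (s : Memory) : (advance i s).rarr = s.rarr := rfl

theorem advance_nreg_self {i : ℕ} (hi : i ≠ 9) (s : Memory) :
    (advance i s).nreg i = s.nreg i + 1 := by
  simp [advance, Instr.exec, hi]

@[simp] theorem advance_nreg_of_ne {i r : ℕ} (hr : r ≠ i) (hr9 : r ≠ 9) (s : Memory) :
    (advance i s).nreg r = s.nreg r := by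
  simp [advance, Instr.exec, hr, hr9]

namespace FProg

open Classical in
/-- The effect of a program on the memory. -/
noncomputable def den : FProg → Memory → Memory
  | instr e, s => e.exec s
  | seq P Q, s => Q.den (P.den s)
  | cond b P Q, s => if b.Holds s then P.den s else Q.den s
  | rep i lim P, s =>
      (fun s' => advance i (P.den s'))^[s.nreg lim] ((Instr.nconst i 0).exec s)

end FProg

/-- Storage locations: registers, and arrays as a whole. -/
inductive Loc where
  | nreg (r : ℕ)
  | narr (a : ℕ)
  | rreg (r : ℕ)
  | rarr (a : ℕ)
  deriving DecidableEq

/-- Two memories agree at a location. -/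
def Loc.Same : Loc → Memory → Memory → Prop
  | nreg r, s, s' => s'.nreg r = s.nreg r
  | narr a, s, s' => s'.narr a = s.narr a
  | rreg r, s, s' => s'.rreg r = s.rreg r
  | rarr a, s, s' => s'.rarr a = s.rarr a

theorem Loc.Same.trans {l : Loc} {s s' s'' : Memory} (h : l.Same s s') (h' : l.Same s' s'') :
    l.Same s s'' := by
  cases l <;> exact Eq.trans h' h

/-- The location written by an instruction. -/
def Instr.writes : Instr → List Loc
  | skip => []
  | nconst d _ | ncopy d _ | nadd d _ _ | nsub d _ _ | nload d _ _ => [.nreg d]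
  | nstore a _ _ => [.narr a]
  | rzero d | rcopy d _ | radd d _ _ | rsub d _ _ | rload d _ _ => [.rreg d]
  | rstore a _ _ => [.rarr a]

theorem Instr.same_exec {l : Loc} {e : Instr} (h : l ∉ e.writes) (s : Memory) :
    l.Same s (e.exec s) := by
  cases e <;> cases l <;> simp_all [Instr.writes, Loc.Same, Instr.exec]

namespace FProg

/-- The locations that a program may write. -/
def writes : FProg → List Loc
  | instr e => e.writes
  | seq P Q => P.writes ++ Q.writes
  | cond _ P Q => P.writes ++ Q.writes
  | rep i _ P => .nreg i :: .nreg 9 :: P.writes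

theorem same_advance {l : Loc} {i : ℕ} (hi : l ≠ .nreg i) (h9 : l ≠ .nreg 9) (s : Memory) :
    l.Same s (advance i s) :=
  (Instr.same_exec (by simpa [Instr.writes] using h9) s).trans
    (Instr.same_exec (by simpa [Instr.writes] using hi) _)

theorem same_den {l : Loc} {P : FProg} (h : l ∉ P.writes) (s : Memory) : l.Same s (P.den s) := by
  induction P generalizing s with
  | instr e => exact Instr.same_exec h s
  | seq P Q ihP ihQ =>
    rw [writes, List.mem_append, not_or] at h
    exact (ihP h.1 s).trans (ihQ h.2 _)
  | cond b P Q ihP ihQ =>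
    rw [writes, List.mem_append, not_or] at h
    rw [den]
    split_ifs
    · exact ihP h.1 s
    · exact ihQ h.2 s
  | rep i lim P ih =>
    simp only [writes, List.mem_cons, not_or] at h
    have hit : ∀ m,
        l.Same s ((fun s' => advance i (P.den s'))^[m] ((Instr.nconst i 0).exec s)) := by
      intro m
      induction m with
      | zero => exact Instr.same_exec (by simpa [Instr.writes] using h.1) s
      | succ m ihm =>
        rw [Function.iterate_succ_apply']
        exact ihm.trans ((ih h.2.2 _).trans (same_advance h.1 h.2.1 _))
    exact hit _

theorem nreg_den {P : FProg} (r : ℕ) (h : .nreg r ∉ P.writes) (s : Memory) :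
    (P.den s).nreg r = s.nreg r := same_den h s

theorem narr_den {P : FProg} (a : ℕ) (h : .narr a ∉ P.writes) (s : Memory) :
    (P.den s).narr a = s.narr a := same_den h s

theorem rreg_den {P : FProg} (r : ℕ) (h : .rreg r ∉ P.writes) (s : Memory) :
    (P.den s).rreg r = s.rreg r := same_den h s

theorem rarr_den {P : FProg} (a : ℕ) (h : .rarr a ∉ P.writes) (s : Memory) :
    (P.den s).rarr a = s.rarr a := same_den h s

/-- Loop invariants: in the induction step, the counter has its value and everything that the loop
does not write is as before the loop. -/
theorem den_rep_induct {i lim : ℕ} {P : FProg} {s : Memory} (hi9 : i ≠ 9)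
    (hi : .nreg i ∉ P.writes) (I : ℕ → Memory → Prop) (h0 : I 0 ((Instr.nconst i 0).exec s))
    (hstep : ∀ m s', m < s.nreg lim → s'.nreg i = m →
      (∀ l ∉ (rep i lim P).writes, l.Same s s') → I m s' → I (m + 1) (advance i (P.den s'))) :
    I (s.nreg lim) ((rep i lim P).den s) := by
  have hit : ∀ m ≤ s.nreg lim,
      let s' := (fun s' => advance i (P.den s'))^[m] ((Instr.nconst i 0).exec s)
      s'.nreg i = m ∧ (∀ l ∉ (rep i lim P).writes, l.Same s s') ∧ I m s' := by
    intro m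
    induction m with
    | zero =>
      refine fun _ => ⟨by simp [Instr.exec], fun l hl => ?_, h0⟩
      exact Instr.same_exec (by simp_all [Instr.writes, writes]) s
    | succ m ih =>
      intro hm
      obtain ⟨h1, h2, h3⟩ := ih (by omega)
      rw [Function.iterate_succ_apply']
      refine ⟨?_, fun l hl => ?_, hstep m _ (by omega) h1 h2 h3⟩
      · rw [advance_nreg_self hi9, nreg_den i hi, h1]
      · have hl' := hl
        simp only [writes, List.mem_cons, not_or] at hl'
        exact (h2 l hl).trans ((same_den hl'.2.2 _).trans (same_advance hl'.1 hl'.2.1 _))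
  exact (hit _ le_rfl).2.2

/-! ### Running time of structured programs -/

/-- Syntactic check of a program: the loop bounds are held by registers in `L`, which are never
written, no loop body writes its counter, and the counters differ from the reserved register. -/
def wf (L : List ℕ) : FProg → Bool
  | instr e => decide (∀ r ∈ L, .nreg r ∉ e.writes)
  | seq P Q => P.wf L && Q.wf L
  | cond _ P Q => P.wf L && Q.wf L
  | rep i lim P => decide (lim ∈ L ∧ i ∉ L ∧ i ≠ 9 ∧ 9 ∉ L ∧ .nreg i ∉ P.writes) && P.wf L

/-- The factor in the bound for the running time: the number of instructions and tests, with the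
overhead of each loop. -/
def size : FProg → ℕ
  | instr _ => 1
  | seq P Q => P.size + Q.size
  | cond _ P Q => P.size + Q.size + 1
  | rep _ _ P => P.size + 5

/-- Nesting depth of the loops. -/
def depth : FProg → ℕ
  | instr _ => 0
  | seq P Q => max P.depth Q.depth
  | cond _ P Q => max P.depth Q.depth
  | rep _ _ P => P.depth + 1

theorem notMem_writes_of_wf {L : List ℕ} {P : FProg} (h : P.wf L) {r : ℕ} (hr : r ∈ L) :
    .nreg r ∉ P.writes := by
  induction P with
  | instr e => exact (of_decide_eq_true h) r hr
  | seq P Q ihP ihQ | cond _ P Q ihP ihQ =>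
    simp only [wf, Bool.and_eq_true] at h
    simp [writes, ihP h.1, ihQ h.2]
  | rep i lim P ih =>
    simp only [wf, Bool.and_eq_true, decide_eq_true_eq] at h
    obtain ⟨⟨-, hi, -, h9, -⟩, h⟩ := h
    simp only [writes, List.mem_cons, Loc.nreg.injEq, not_or]
    exact ⟨fun he => hi (he ▸ hr), fun he => h9 (he ▸ hr), ih h⟩

/-- If the loop bounds are at most `M`, the running time is at most `size * M ^ depth`. -/
theorem exists_runs {L : List ℕ} {P : FProg} (h : P.wf L) {M : ℕ} (hM : 1 ≤ M) {s : Memory}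
    (hs : ∀ r ∈ L, s.nreg r ≤ M) :
    ∃ k, P.compile.Runs s k (P.den s) ∧ k ≤ P.size * M ^ P.depth := by
  induction P generalizing s with
  | instr e => exact ⟨1, .instr e s, by simp [size, depth]⟩
  | seq P Q ihP ihQ =>
    simp only [wf, Bool.and_eq_true] at h
    obtain ⟨k, hk, hkle⟩ := ihP h.1 hs
    obtain ⟨l, hl, hlle⟩ := ihQ h.2 (s := P.den s) fun r hr => by
      rw [nreg_den r (notMem_writes_of_wf h.1 hr)]; exact hs r hr
    refine ⟨k + l, .seq hk hl, ?_⟩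
    have h1 := Nat.pow_le_pow_right hM (le_max_left P.depth Q.depth)
    have h2 := Nat.pow_le_pow_right hM (le_max_right P.depth Q.depth)
    rw [size, depth, add_mul]
    exact Nat.add_le_add (hkle.trans (Nat.mul_le_mul_left _ h1))
      (hlle.trans (Nat.mul_le_mul_left _ h2))
  | cond b P Q ihP ihQ =>
    simp only [wf, Bool.and_eq_true] at h
    have h1 := Nat.pow_le_pow_right hM (le_max_left P.depth Q.depth)
    have h2 := Nat.pow_le_pow_right hM (le_max_right P.depth Q.depth)
    have h3 : 1 ≤ M ^ max P.depth Q.depth := Nat.one_le_pow _ _ hM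
    have h4 := Nat.mul_le_mul_left P.size h1
    have h5 := Nat.mul_le_mul_left Q.size h2
    by_cases hb : b.Holds s
    · obtain ⟨k, hk, hkle⟩ := ihP h.1 hs
      refine ⟨k + 1, ?_, ?_⟩
      · rw [den, if_pos hb]; exact .cond_true hb hk
      · rw [size, depth, add_mul, add_mul]; omega
    · obtain ⟨k, hk, hkle⟩ := ihQ h.2 hs
      refine ⟨k + 1, ?_, ?_⟩
      · rw [den, if_neg hb]; exact .cond_false hb hk
      · rw [size, depth, add_mul, add_mul]; omega
  | rep i lim P ih =>
    simp only [wf, Bool.and_eq_true, decide_eq_true_eq] at h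
    obtain ⟨⟨hlim, hi, hi9, h9, hiP⟩, hwf⟩ := h
    set K := P.size * M ^ P.depth with hK
    -- `m` remaining iterations
    have hloop : ∀ m s', (∀ r ∈ L, s'.nreg r ≤ M) → s'.nreg i + m = s'.nreg lim →
        ∃ k, (Program.loop (.nlt i lim) (.seq P.compile
          (.seq (.instr (.nconst 9 1)) (.instr (.nadd i i 9))))).Runs s' k
            ((fun s' => advance i (P.den s'))^[m] s') ∧ k ≤ m * (K + 3) + 1 := by
      intro m
      induction m with
      | zero =>
        intro s' _ hm
        exact ⟨1, .loop_done (by simp [Test.Holds]; omega), by omega⟩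
      | succ m ihm =>
        intro s' hs' hm
        obtain ⟨k, hk, hkle⟩ := ih hwf hs'
        have hL : ∀ r ∈ L, (advance i (P.den s')).nreg r = s'.nreg r := fun r hr => by
          rw [advance_nreg_of_ne (by rintro rfl; exact hi hr) (by rintro rfl; exact h9 hr),
            nreg_den r (notMem_writes_of_wf hwf hr)]
        obtain ⟨l, hl, hlle⟩ := ihm (advance i (P.den s'))
          (fun r hr => by rw [hL r hr]; exact hs' r hr)
          (by rw [hL lim hlim, advance_nreg_self hi9, nreg_den i hiP]; omega)
        refine ⟨k + (1 + 1) + l + 1, ?_, ?_⟩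
        · rw [Function.iterate_succ_apply]
          exact .loop_step (by simp only [Test.Holds]; omega)
            (.seq hk (.seq (.instr _ _) (.instr _ _))) hl
        · rw [add_mul]; omega
    have hlim_i : lim ≠ i := fun he => hi (he ▸ hlim)
    obtain ⟨k, hk, hkle⟩ := hloop (s.nreg lim) ((Instr.nconst i 0).exec s)
      (fun r hr => by
        have : r ≠ i := fun he => hi (he ▸ hr)
        simpa [Instr.exec, this] using hs r hr)
      (by simp [Instr.exec, hlim_i])
    refine ⟨1 + k, .seq (.instr _ _) hk, ?_⟩
    have h1 : s.nreg lim * (K + 3) ≤ M * (K + 3) := Nat.mul_le_mul_right _ (hs lim hlim)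
    have h2 : 1 ≤ M ^ P.depth := Nat.one_le_pow _ _ hM
    rw [size, depth, pow_succ]
    calc 1 + k ≤ M * (K + 3) + 2 := by omega
      _ ≤ M * (K + 5) := by nlinarith
      _ ≤ (P.size + 5) * (M ^ P.depth * M) := by rw [hK]; nlinarith

end FProg

open Finset

namespace FProg

@[simp] theorem den_block_nil (s : Memory) : (block []).den s = s := rfl

@[simp] theorem den_block_cons (P : FProg) (Ps : List FProg) (s : Memory) :
    (block (P :: Ps)).den s = (block Ps).den (P.den s) := rfl

@[simp] theorem den_instr (e : Instr) (s : Memory) : (instr e).den s = e.exec s := rfl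

theorem den_cond_pos {b : Test} {P Q : FProg} {s : Memory} (h : b.Holds s) :
    (cond b P Q).den s = P.den s := if_pos h

theorem den_cond_neg {b : Test} {P Q : FProg} {s : Memory} (h : ¬ b.Holds s) :
    (cond b P Q).den s = Q.den s := if_neg h

end FProg

/-! ### Program pieces -/

/-- The array contents `f` represent the subset `S` of `{0, …, n - 1}` by its indicator. -/
def Encodes (f : ℕ → ℕ) (n : ℕ) (S : Finset ℕ) : Prop :=
  S ⊆ range n ∧ ∀ i < n, f i = if i ∈ S then 1 else 0

theorem Encodes.eq_one_iff {f : ℕ → ℕ} {n : ℕ} {S : Finset ℕ} (h : Encodes f n S) {i : ℕ}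
    (hi : i < n) : f i = 1 ↔ i ∈ S := by
  rw [h.2 i hi]; split_ifs with hS <;> simp [hS]

theorem Encodes.of_filter {f : ℕ → ℕ} {n : ℕ} {q : ℕ → Prop} [DecidablePred q]
    (h : ∀ i < n, f i = if q i then 1 else 0) : Encodes f n {i ∈ range n | q i} :=
  ⟨filter_subset _ _, fun i hi => by simp [h i hi, hi]⟩

/-- The registers read by every program piece: the natural registers `0`, `3`, `4` hold `n`, `1`
and `0`. -/
structure Ready (n : ℕ) (s : Memory) : Prop where
  n_eq : s.nreg 0 = n
  one : s.nreg 3 = 1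
  zero : s.nreg 4 = 0

theorem Ready.of_same {n : ℕ} {s s' : Memory} {W : List Loc} (hr : Ready n s)
    (h : ∀ l ∉ W, l.Same s s')
    (h0 : .nreg 0 ∉ W := by simp [FProg.writes, Instr.writes, FProg.block])
    (h3 : .nreg 3 ∉ W := by simp [FProg.writes, Instr.writes, FProg.block])
    (h4 : .nreg 4 ∉ W := by simp [FProg.writes, Instr.writes, FProg.block]) : Ready n s' :=
  ⟨Eq.trans (h _ h0 : s'.nreg 0 = s.nreg 0) hr.n_eq,
    Eq.trans (h _ h3 : s'.nreg 3 = s.nreg 3) hr.one,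
    Eq.trans (h _ h4 : s'.nreg 4 = s.nreg 4) hr.zero⟩

theorem Ready.den {n : ℕ} {s : Memory} (hr : Ready n s) {P : FProg}
    (h : ∀ l ∈ [Loc.nreg 0, .nreg 3, .nreg 4], l ∉ P.writes) : Ready n (P.den s) :=
  hr.of_same (W := P.writes) (fun _ hl => FProg.same_den hl s) (h _ (by simp)) (h _ (by simp))
    (h _ (by simp))

namespace FProg

/-- Copy the first `n` cells of the natural array `src` to the array `dst`. -/
def copyArray (src dst : ℕ) : FProg :=
  rep 6 0 (block [Instr.nload 12 src 6, Instr.nstore dst 6 12])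

theorem den_copyArray {src dst n : ℕ} (h : src ≠ dst) {s : Memory} {S : Finset ℕ}
    (hr : Ready n s) (hS : Encodes (s.narr src) n S) :
    Encodes (((copyArray src dst).den s).narr dst) n S := by
  suffices H : ∀ i < s.nreg 0, ((copyArray src dst).den s).narr dst i = s.narr src i from
    ⟨hS.1, fun i hi => by rw [H i (by rw [hr.n_eq]; exact hi), hS.2 i hi]⟩
  refine den_rep_induct (I := fun m s' => ∀ i < m, s'.narr dst i = s.narr src i) (by decide)
    (by simp [writes, block, Instr.writes]) (by simp) ?_
  intro m s' hm hi hsame hI i hlt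
  have hsrc : s'.narr src = s.narr src :=
    hsame (.narr src) (by simp [writes, block, Instr.writes, h])
  by_cases him : i = m
  · subst him; simp [Instr.exec, hi, hsrc]
  · simp [Instr.exec, hi, him, hI i (by omega)]

/-- Write the complement of the set in the array `src` to the array `dst`. -/
def complement (src dst : ℕ) : FProg :=
  rep 6 0 (block [Instr.nload 12 src 6,
    cond (.neq 12 3) (Instr.nstore dst 6 4) (Instr.nstore dst 6 3)])

theorem den_complement {src dst n : ℕ} (h : src ≠ dst) {s : Memory} {S : Finset ℕ}
    (hr : Ready n s) (hS : Encodes (s.narr src) n S) :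
    Encodes (((complement src dst).den s).narr dst) n (range n \ S) := by
  suffices H : ∀ i < s.nreg 0, ((complement src dst).den s).narr dst i =
      if s.narr src i = 1 then 0 else 1 by
    refine ⟨sdiff_subset, fun i hi => ?_⟩
    rw [H i (by rw [hr.n_eq]; exact hi)]
    simp only [hS.eq_one_iff hi, mem_sdiff, mem_range, hi, true_and]
    split_ifs <;> rfl
  refine den_rep_induct (I := fun m s' => ∀ i < m, s'.narr dst i =
    if s.narr src i = 1 then 0 else 1) (by decide)
    (by simp [writes, block, Instr.writes]) (by simp) ?_
  intro m s' hm hi hsame hI i hlt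
  have hsrc : s'.narr src = s.narr src :=
    hsame (.narr src) (by simp [writes, block, Instr.writes, h])
  have hr' := hr.of_same hsame
  have h3 := hr'.one
  have h4 := hr'.zero
  by_cases him : i = m
  · subst him
    by_cases hc : s.narr src i = 1 <;>
      simp [den, Test.Holds, Instr.exec, hi, hsrc, h3, h4, hc]
  · by_cases hc : s.narr src m = 1 <;>
      simp [den, Test.Holds, Instr.exec, hi, hsrc, h3, hc, him, hI i (by omega)]

/-- Mark in the natural array `4` the items with deviation at most `π0`, and in the array `3` the
other items with deviation at most `π1`. -/
def markItems : FProg :=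
  rep 6 0 (block [Instr.rload 2 0 6, Instr.rload 3 1 6, Instr.rsub 2 3 2,
    cond (.rle 2 0) (block [Instr.nstore 3 6 4, Instr.nstore 4 6 3])
      (block [Instr.nstore 4 6 4,
        cond (.rle 2 1) (Instr.nstore 3 6 3) (Instr.nstore 3 6 4)])])

theorem den_markItems {n : ℕ} {s : Memory} (hr : Ready n s) :
    Encodes ((markItems.den s).narr 4) n
      {i ∈ range n | s.rarr 1 i - s.rarr 0 i ≤ s.rreg 0} ∧
    Encodes ((markItems.den s).narr 3) n
      {i ∈ range n | s.rreg 0 < s.rarr 1 i - s.rarr 0 i ∧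
        s.rarr 1 i - s.rarr 0 i ≤ s.rreg 1} := by
  suffices H : ∀ i < s.nreg 0,
      (markItems.den s).narr 4 i = (if s.rarr 1 i - s.rarr 0 i ≤ s.rreg 0 then 1 else 0) ∧
      (markItems.den s).narr 3 i = (if s.rreg 0 < s.rarr 1 i - s.rarr 0 i ∧
        s.rarr 1 i - s.rarr 0 i ≤ s.rreg 1 then 1 else 0) by
    rw [hr.n_eq] at H
    exact ⟨.of_filter fun i hi => (H i hi).1, .of_filter fun i hi => (H i hi).2⟩
  refine den_rep_induct (I := fun m s' => ∀ i < m,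
    s'.narr 4 i = (if s.rarr 1 i - s.rarr 0 i ≤ s.rreg 0 then 1 else 0) ∧
    s'.narr 3 i = (if s.rreg 0 < s.rarr 1 i - s.rarr 0 i ∧
        s.rarr 1 i - s.rarr 0 i ≤ s.rreg 1 then 1 else 0)) (by decide)
    (by decide) (by simp) ?_
  intro m s' hm hi hsame hI i hlt
  have hr' := hr.of_same hsame
  have h3 := hr'.one
  have h4 := hr'.zero
  have ha0 : s'.rarr 0 = s.rarr 0 := hsame (.rarr 0) (by decide)
  have ha1 : s'.rarr 1 = s.rarr 1 := hsame (.rarr 1) (by decide)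
  have hr0 : s'.rreg 0 = s.rreg 0 := hsame (.rreg 0) (by decide)
  have hr1 : s'.rreg 1 = s.rreg 1 := hsame (.rreg 1) (by decide)
  by_cases him : i = m
  · subst him
    by_cases hc : s.rarr 1 i - s.rarr 0 i ≤ s.rreg 0
    · simp [den, Test.Holds, Instr.exec, hi, h3, h4, ha0, ha1, hr0, hc, not_lt.2 hc]
    · by_cases hc1 : s.rarr 1 i - s.rarr 0 i ≤ s.rreg 1 <;>
        simp [den, Test.Holds, Instr.exec, hi, h3, h4, ha0, ha1, hr0, hr1, hc, hc1, not_le.1 hc]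
  · have hI' := hI i (by omega)
    by_cases hc : s.rarr 1 m - s.rarr 0 m ≤ s.rreg 0
    · simp [den, Test.Holds, Instr.exec, hi, h3, h4, ha0, ha1, hr0, hc, him, hI']
    · by_cases hc1 : s.rarr 1 m - s.rarr 0 m ≤ s.rreg 1 <;>
        simp [den, Test.Holds, Instr.exec, hi, h3, h4, ha0, ha1, hr0, hr1, hc, hc1, him, hI']

/-- Add one to the natural register `8` if item `j` (register `7`) is in the set in the array
`cand` and comes before item `i` (register `6`), whose cost is in the real register `2`. -/
def countStep (cand : ℕ) : FProg :=
  block [Instr.nload 12 cand 7,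
    cond (.neq 12 3)
      (block [Instr.rload 3 0 7,
        cond (.rlt 3 2) (Instr.nadd 8 8 3)
          (cond (.rle 3 2) (cond (.nlt 7 6) (Instr.nadd 8 8 3) Instr.skip) Instr.skip)])
      Instr.skip]

open Classical in
theorem den_countStep {cand : ℕ} {s : Memory} (h3 : s.nreg 3 = 1)
    (h2 : s.rreg 2 = s.rarr 0 (s.nreg 6)) :
    ((countStep cand).den s).nreg 8 = s.nreg 8 +
      if s.narr cand (s.nreg 7) = 1 ∧ Before (s.rarr 0) (s.nreg 7) (s.nreg 6) then 1 else 0 := by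
  by_cases hc : s.narr cand (s.nreg 7) = 1
  · by_cases h1 : s.rarr 0 (s.nreg 7) < s.rarr 0 (s.nreg 6)
    · simp [countStep, den, Test.Holds, Instr.exec, Before, h3, h2, hc, h1]
    · by_cases h4 : s.rarr 0 (s.nreg 7) ≤ s.rarr 0 (s.nreg 6)
      · by_cases h5 : s.nreg 7 < s.nreg 6 <;>
          simp [countStep, den, Test.Holds, Instr.exec, Before, h3, h2, hc, h1, h4, h5]
      · simp [countStep, den, Test.Holds, Instr.exec, Before, h3, h2, hc, h1, h4]
  · simp [countStep, den, Test.Holds, Instr.exec, h3, hc]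

/-- The inner loop computes the rank of item `i` (register `6`). -/
theorem den_count {cand n : ℕ} {s : Memory} {S : Finset ℕ} (hr : Ready n s)
    (hS : Encodes (s.narr cand) n S) (h8 : s.nreg 8 = 0) (h2 : s.rreg 2 = s.rarr 0 (s.nreg 6)) :
    ((rep 7 0 (countStep cand)).den s).nreg 8 = rank (s.rarr 0) S (s.nreg 6) := by
  classical
  have H : ((rep 7 0 (countStep cand)).den s).nreg 8 =
      #{j ∈ range (s.nreg 0) | s.narr cand j = 1 ∧ Before (s.rarr 0) j (s.nreg 6)} := by
    refine den_rep_induct (I := fun m s' => s'.nreg 8 =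
      #{j ∈ range m | s.narr cand j = 1 ∧ Before (s.rarr 0) j (s.nreg 6)}) (by decide)
      (by simp [countStep, writes, block, Instr.writes]) (by simp [Instr.exec, h8]) ?_
    intro m s' hm hi hsame hI
    have hr' := hr.of_same hsame (by simp [countStep, writes, block, Instr.writes])
      (by simp [countStep, writes, block, Instr.writes])
      (by simp [countStep, writes, block, Instr.writes])
    have ha0 : s'.rarr 0 = s.rarr 0 :=
      hsame (.rarr 0) (by simp [countStep, writes, block, Instr.writes])
    have ha : s'.narr cand = s.narr cand :=
      hsame (.narr cand) (by simp [countStep, writes, block, Instr.writes])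
    have h6 : s'.nreg 6 = s.nreg 6 :=
      hsame (.nreg 6) (by simp [countStep, writes, block, Instr.writes])
    have hr2 : s'.rreg 2 = s.rreg 2 :=
      hsame (.rreg 2) (by simp [countStep, writes, block, Instr.writes])
    rw [advance_nreg_of_ne (by decide) (by decide),
      den_countStep hr'.one (by rw [hr2, h2, ha0, h6]), hI, ha, ha0, h6, hi, range_add_one,
      filter_insert]
    split_ifs with h
    · rw [card_insert_of_notMem (by simp)]
    · rfl
  rw [H, rank, hr.n_eq]
  congr 1
  ext j
  simp only [mem_filter, mem_range]
  constructor
  · rintro ⟨h1, h2, h3⟩; exact ⟨(hS.eq_one_iff h1).1 h2, h3⟩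
  · rintro ⟨h1, h2⟩
    have := mem_range.1 (hS.1 h1)
    exact ⟨this, (hS.eq_one_iff this).2 h1, h2⟩

/-- Add item `i` (register `6`) to the set in the array `out` if it is in the set in the array
`cand` and the natural register `8` is less than the register `10`. -/
def selectItem (cand out : ℕ) : FProg :=
  block [Instr.nload 12 cand 6,
    cond (.neq 12 3)
      (cond (.nlt 8 10)
        (block [Instr.nstore out 6 3, Instr.nadd 13 13 3, Instr.radd 4 4 2])
        (Instr.nstore out 6 4))
      (Instr.nstore out 6 4)]

/-- Write the `N[10]` cheapest elements of the set in the array `cand` to the array `out`, their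
number to the natural register `13` and their total cost to the real register `4`. An element is
taken if the number of the elements before it is less than `N[10]`. -/
def selectCheapest (cand out : ℕ) : FProg :=
  block [Instr.nconst 13 0, Instr.rzero 4,
    rep 6 0 (block [Instr.nconst 8 0, Instr.rload 2 0 6, rep 7 0 (countStep cand),
      selectItem cand out])]

theorem den_selectItem {cand out : ℕ} {s : Memory} (h3 : s.nreg 3 = 1)
    (h4 : s.nreg 4 = 0) {q : Prop} [Decidable q]
    (hq : q ↔ s.narr cand (s.nreg 6) = 1 ∧ s.nreg 8 < s.nreg 10) :
    ((selectItem cand out).den s).narr out =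
      Function.update (s.narr out) (s.nreg 6) (if q then 1 else 0) ∧
    ((selectItem cand out).den s).nreg 13 = s.nreg 13 + (if q then 1 else 0) ∧
    ((selectItem cand out).den s).rreg 4 = s.rreg 4 + (if q then s.rreg 2 else 0) := by
  by_cases h1 : s.narr cand (s.nreg 6) = 1
  · by_cases h2 : s.nreg 8 < s.nreg 10 <;>
      simp [selectItem, den, Test.Holds, Instr.exec, h3, h4, h1, h2, hq]
  · simp [selectItem, den, Test.Holds, Instr.exec, h3, h4, h1, hq]

theorem den_selectCheapest {cand out n : ℕ} (h : cand ≠ out) {s : Memory} {S : Finset ℕ}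
    (hr : Ready n s) (hS : Encodes (s.narr cand) n S) :
    let s' := (selectCheapest cand out).den s
    let T := cheapest (s.rarr 0) S (s.nreg 10)
    Encodes (s'.narr out) n T ∧ s'.nreg 13 = #T ∧ s'.rreg 4 = ∑ i ∈ T, s.rarr 0 i := by
  classical
  intro s' T
  set s0 := (Instr.rzero 4).exec ((Instr.nconst 13 0).exec s) with hs0
  have hr0 : Ready n s0 := ⟨hr.n_eq, hr.one, hr.zero⟩
  set body := block [Instr.nconst 8 0, Instr.rload 2 0 6, rep 7 0 (countStep cand),
      selectItem cand out] with hbody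
  have hTr : T ⊆ range n := (cheapest_subset _).trans hS.1
  have H : (∀ i < s0.nreg 0, s'.narr out i = if i ∈ T then 1 else 0) ∧
      s'.nreg 13 = #{i ∈ range (s0.nreg 0) | i ∈ T} ∧
      s'.rreg 4 = ∑ i ∈ range (s0.nreg 0) with i ∈ T, s.rarr 0 i := by
    refine den_rep_induct (i := 6) (lim := 0) (P := body) (s := s0)
      (I := fun m s' => (∀ i < m, s'.narr out i = if i ∈ T then 1 else 0) ∧
      s'.nreg 13 = #{i ∈ range m | i ∈ T} ∧
      s'.rreg 4 = ∑ i ∈ range m with i ∈ T, s.rarr 0 i) (by decide)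
      (by simp [hbody, selectItem, countStep, writes, block, Instr.writes])
      (by simp [hs0, Instr.exec]) ?_
    intro m s1 hm h6 hsame ⟨hI1, hI2, hI3⟩
    have hr1 := hr0.of_same hsame
      (by simp [hbody, selectItem, countStep, writes, block, Instr.writes])
      (by simp [hbody, selectItem, countStep, writes, block, Instr.writes])
      (by simp [hbody, selectItem, countStep, writes, block, Instr.writes])
    have ha0 : s1.rarr 0 = s.rarr 0 := hsame (.rarr 0)
      (by simp [hbody, selectItem, countStep, writes, block, Instr.writes])
    have ha : s1.narr cand = s.narr cand := hsame (.narr cand)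
      (by simp [hbody, selectItem, countStep, writes, block, Instr.writes, h])
    have h10 : s1.nreg 10 = s.nreg 10 := hsame (.nreg 10)
      (by simp [hbody, selectItem, countStep, writes, block, Instr.writes])
    set s2 := (Instr.rload 2 0 6).exec ((Instr.nconst 8 0).exec s1) with hs2
    set s3 := (rep 7 0 (countStep cand)).den s2 with hs3
    have hr2 : Ready n s2 := ⟨hr1.n_eq, hr1.one, hr1.zero⟩
    have hcount : s3.nreg 8 = rank (s.rarr 0) S m := by
      rw [hs3, den_count hr2 (S := S) (by simpa [hs2, Instr.exec, ha] using hS)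
        (by simp [hs2, Instr.exec]) (by simp [hs2, Instr.exec])]
      simp [hs2, Instr.exec, ha0, h6]
    have e3 : s3.nreg 3 = 1 := (nreg_den 3
      (by simp [countStep, writes, block, Instr.writes]) s2).trans hr2.one
    have e4 : s3.nreg 4 = 0 := (nreg_den 4
      (by simp [countStep, writes, block, Instr.writes]) s2).trans hr2.zero
    have e6 : s3.nreg 6 = m := (nreg_den 6
      (by simp [countStep, writes, block, Instr.writes]) s2).trans (by simp [hs2, Instr.exec, h6])
    have e10 : s3.nreg 10 = s.nreg 10 := (nreg_den 10
      (by simp [countStep, writes, block, Instr.writes]) s2).trans (by simp [hs2, Instr.exec, h10])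
    have e13 : s3.nreg 13 = s1.nreg 13 := (nreg_den 13
      (by simp [countStep, writes, block, Instr.writes]) s2).trans (by simp [hs2, Instr.exec])
    have er4 : s3.rreg 4 = s1.rreg 4 := (rreg_den 4
      (by simp [countStep, writes, block, Instr.writes]) s2).trans (by simp [hs2, Instr.exec])
    have er2 : s3.rreg 2 = s.rarr 0 m := (rreg_den 2
      (by simp [countStep, writes, block, Instr.writes]) s2).trans
        (by simp [hs2, Instr.exec, h6, ha0])
    have eout : s3.narr out = s1.narr out := (narr_den out
      (by simp [countStep, writes, block, Instr.writes]) s2).trans (by simp [hs2, Instr.exec])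
    have ecand : s3.narr cand = s.narr cand := (narr_den cand
      (by simp [countStep, writes, block, Instr.writes]) s2).trans (by simp [hs2, Instr.exec, ha])
    have hmn : m < n := by rw [← hr0.n_eq]; exact hm
    obtain ⟨f1, f2, f3⟩ := den_selectItem e3 e4 (q := m ∈ T) (by
      rw [e6, ecand, hS.eq_one_iff hmn, hcount, e10]
      simp [T, cheapest])
    have hden : body.den s1 = (selectItem cand out).den s3 := rfl
    rw [hden]
    refine ⟨fun i hi => ?_, ?_, ?_⟩
    · rw [advance_narr, f1, e6, eout]
      by_cases him : i = m
      · subst him; simp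
      · rw [Function.update_of_ne him, hI1 i (by omega)]
    · rw [advance_nreg_of_ne (by decide) (by decide), f2, e13, hI2, range_add_one,
        filter_insert]
      split_ifs with hT
      · rw [card_insert_of_notMem (by simp)]
      · rfl
    · rw [advance_rreg, f3, er4, er2, hI3, range_add_one, filter_insert]
      split_ifs with hT
      · rw [sum_insert (by simp), add_comm]
      · rw [add_zero]
  have hfilter : {i ∈ range (s0.nreg 0) | i ∈ T} = T := by
    rw [hr0.n_eq]
    ext i
    simp only [mem_filter, and_iff_right_iff_imp]
    exact fun hi => hTr hi
  rw [hfilter] at H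
  rw [hr0.n_eq] at H
  exact ⟨⟨hTr, H.1⟩, H.2.1, H.2.2⟩

end FProg

/-! ### Subproblems in terms of sets -/

section Sets

variable {n p : ℕ} {lo hi : Fin n → ℝ}

/-- The vector of length `n` that indicates a set of natural numbers. -/
def indicatorVec (n : ℕ) (S : Finset ℕ) : Fin n → ℝ := fun i => if (i : ℕ) ∈ S then 1 else 0

theorem isBinary_indicatorVec (S : Finset ℕ) : IsBinary (indicatorVec n S) := fun i => by
  unfold indicatorVec; split_ifs <;> simp

theorem Encodes.output_eq {s : Memory} {a : ℕ} {S : Finset ℕ} (h : Encodes (s.narr a) n S) :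
    output s n a = indicatorVec n S := by
  funext i
  rw [output, indicatorVec, h.2 i i.2]
  split_ifs <;> simp

theorem toArray_apply (v : Fin n → ℝ) (i : Fin n) : toArray v i = v i := by simp [toArray]

theorem IsBinary.exists_eq_indicatorVec {x : Fin n → ℝ} (hx : IsBinary x) :
    ∃ S ⊆ range n, x = indicatorVec n S := by
  classical
  refine ⟨{i ∈ range n | toArray x i = 1}, filter_subset _ _, ?_⟩
  funext i
  rcases hx i with h | h <;> simp [indicatorVec, toArray_apply, h]

theorem sum_mul_indicatorVec {S : Finset ℕ} (hS : S ⊆ range n) (v : Fin n → ℝ) :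
    ∑ i, v i * indicatorVec n S i = ∑ i ∈ S, toArray v i := by
  calc ∑ i, v i * indicatorVec n S i
      = ∑ i : Fin n, (fun j : ℕ => if j ∈ S then toArray v j else 0) i :=
        sum_congr rfl fun i _ => by simp [indicatorVec, toArray_apply]
    _ = ∑ i ∈ range n, if i ∈ S then toArray v i else 0 :=
        Fin.sum_univ_eq_sum_range (fun j => if j ∈ S then toArray v j else 0) n
    _ = ∑ i ∈ S, toArray v i := by rw [sum_ite_mem, inter_eq_right.2 hS]

theorem sum_indicatorVec {S : Finset ℕ} (hS : S ⊆ range n) :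
    ∑ i, indicatorVec n S i = #S := by
  have h := sum_mul_indicatorVec hS (fun _ => (1 : ℝ))
  simp only [one_mul] at h
  rw [h, sum_congr rfl (g := fun _ => (1 : ℝ)) fun i hi => ?_]
  · simp
  · simp [toArray, mem_range.1 (hS hi)]

theorem indicatorVec_mem_secondStage {X Y : Finset ℕ} (hX : X ⊆ range n) (hY : Y ⊆ range n) :
    indicatorVec n Y ∈ secondStage (selection n p) (indicatorVec n X) ↔
      Disjoint X Y ∧ #X + #Y = p := by
  have hsum : ∑ i, (indicatorVec n X + indicatorVec n Y) i = ((#X + #Y : ℕ) : ℝ) := by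
    simp [sum_add_distrib, sum_indicatorVec hX, sum_indicatorVec hY]
  constructor
  · rintro ⟨-, hle, -, hp⟩
    rw [hsum, Nat.cast_inj] at hp
    refine ⟨disjoint_left.2 fun i hiX hiY => ?_, hp⟩
    have := hle ⟨i, mem_range.1 (hX hiX)⟩
    simp only [indicatorVec, hiX, hiY, if_true] at this
    norm_num at this
  · rintro ⟨hd, hp⟩
    refine ⟨isBinary_indicatorVec Y, fun i => ?_, fun i => ?_, by rw [hsum, hp]⟩ <;>
      have hi : (i : ℕ) ∈ X → (i : ℕ) ∉ Y := fun h => disjoint_left.1 hd h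
    · by_cases h1 : (i : ℕ) ∈ X
      · simp [indicatorVec, h1, hi h1]
      · by_cases h2 : (i : ℕ) ∈ Y <;> simp [indicatorVec, h1, h2]
    · by_cases h1 : (i : ℕ) ∈ X
      · simp [indicatorVec, h1, hi h1]
      · by_cases h2 : (i : ℕ) ∈ Y <;> simp [indicatorVec, h1, h2]

theorem indicatorVec_eq_zero_of_lt_iff {S : Finset ℕ} (hS : S ⊆ range n) (π : ℝ) :
    (∀ i, π < hi i - lo i → indicatorVec n S i = 0) ↔
      ∀ i ∈ S, toArray hi i - toArray lo i ≤ π := by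
  constructor
  · intro h i hi
    have hin := mem_range.1 (hS hi)
    by_contra hlt
    have := h ⟨i, hin⟩ (by simpa only [toArray, hin, dif_pos, not_le] using hlt)
    simp [indicatorVec, hi] at this
  · intro h i hlt
    have : (i : ℕ) ∉ S := fun hi' => by
      have := h i hi'
      rw [toArray_apply, toArray_apply] at this
      linarith
    simp [indicatorVec, this]

theorem subFeasible_indicatorVec {π0 π1 t : ℝ} {X Y0 Y1 : Finset ℕ} (hX : X ⊆ range n)
    (hY0 : Y0 ⊆ range n) (hY1 : Y1 ⊆ range n) :
    SubFeasible (selection n p) lo hi π0 π1 t (indicatorVec n X) (indicatorVec n Y0)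
        (indicatorVec n Y1) ↔
      π0 + ∑ i ∈ Y0, toArray lo i + ∑ i ∈ X, toArray lo i ≤ t ∧
      π1 + ∑ i ∈ Y1, toArray lo i + ∑ i ∈ X, toArray lo i ≤ t ∧
      (Disjoint X Y0 ∧ #X + #Y0 = p) ∧ (Disjoint X Y1 ∧ #X + #Y1 = p) ∧
      (∀ i ∈ Y0, toArray hi i - toArray lo i ≤ π0) ∧
      (∀ i ∈ X, toArray hi i - toArray lo i ≤ π1) := by
  rw [SubFeasible, sum_mul_indicatorVec hX, sum_mul_indicatorVec hY0, sum_mul_indicatorVec hY1,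
    indicatorVec_mem_secondStage hX hY0, indicatorVec_mem_secondStage hX hY1,
    indicatorVec_eq_zero_of_lt_iff hY0, indicatorVec_eq_zero_of_lt_iff hX]
  simp only [isBinary_indicatorVec, true_and]

end Sets

/-- The data of a subproblem; the cost bounds `w`, `v` are given as array contents. -/
structure SubData where
  n : ℕ
  p : ℕ
  w : ℕ → ℝ
  v : ℕ → ℝ
  π0 : ℝ
  π1 : ℝ

namespace SubData

variable (D : SubData)

/-- The items allowed for `y0`. -/
noncomputable def F : Finset ℕ := {i ∈ range D.n | D.v i - D.w i ≤ D.π0}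

/-- The items allowed for `x`, but not for `y0`. -/
noncomputable def C : Finset ℕ :=
  {i ∈ range D.n | D.π0 < D.v i - D.w i ∧ D.v i - D.w i ≤ D.π1}

/-- First stage of the `k`-th candidate solution. -/
noncomputable def X (k : ℕ) : Finset ℕ := cheapest D.w D.C k

/-- Second stage `y0` of the `k`-th candidate solution. -/
noncomputable def Y0 (k : ℕ) : Finset ℕ := cheapest D.w D.F (D.p - k)

/-- Second stage `y1` of the `k`-th candidate solution. -/
noncomputable def Y1 (k : ℕ) : Finset ℕ := cheapest D.w (range D.n \ D.X k) (D.p - k)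

/-- The `k`-th candidate solution is feasible. -/
def Valid (k : ℕ) : Prop := #(D.X k) + #(D.Y0 k) = D.p

/-- Objective value of the `k`-th candidate solution. -/
noncomputable def value (k : ℕ) : ℝ :=
  max (∑ i ∈ D.X k, D.w i + ∑ i ∈ D.Y0 k, D.w i + D.π0)
    (∑ i ∈ D.X k, D.w i + ∑ i ∈ D.Y1 k, D.w i + D.π1)

theorem F_subset : D.F ⊆ range D.n := filter_subset _ _

theorem C_subset : D.C ⊆ range D.n := filter_subset _ _

theorem X_subset (k : ℕ) : D.X k ⊆ range D.n := (cheapest_subset _).trans D.C_subset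

theorem Y0_subset (k : ℕ) : D.Y0 k ⊆ range D.n := (cheapest_subset _).trans D.F_subset

theorem Y1_subset (k : ℕ) : D.Y1 k ⊆ range D.n := (cheapest_subset _).trans sdiff_subset

/-- The subproblem given by vectors. -/
def ofVec {n : ℕ} (p : ℕ) (lo hi : Fin n → ℝ) (π0 π1 : ℝ) : SubData :=
  ⟨n, p, toArray lo, toArray hi, π0, π1⟩

variable {n p : ℕ} {lo hi : Fin n → ℝ} {π0 π1 : ℝ}

theorem Valid.subFeasible (hp : p ≤ n) {k : ℕ} (hk : (ofVec p lo hi π0 π1).Valid k) :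
    SubFeasible (selection n p) lo hi π0 π1 ((ofVec p lo hi π0 π1).value k)
      (indicatorVec n ((ofVec p lo hi π0 π1).X k)) (indicatorVec n ((ofVec p lo hi π0 π1).Y0 k))
      (indicatorVec n ((ofVec p lo hi π0 π1).Y1 k)) := by
  set D := ofVec p lo hi π0 π1 with hD
  have hXC : D.X k ⊆ D.C := cheapest_subset _
  have hYF : D.Y0 k ⊆ D.F := cheapest_subset _
  have hY1 : D.Y1 k ⊆ range n \ D.X k := cheapest_subset _
  have hcX : #(D.X k) ≤ k := (card_cheapest _).trans_le (min_le_left _ _)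
  have hcY0 : #(D.Y0 k) ≤ p - k := (card_cheapest _).trans_le (min_le_left _ _)
  have hcY1 : #(D.Y1 k) = min (p - k) (n - #(D.X k)) := by
    rw [Y1, card_cheapest, card_sdiff_of_subset (D.X_subset k), card_range]; rfl
  have hk' : #(D.X k) + #(D.Y0 k) = p := hk
  refine (subFeasible_indicatorVec (D.X_subset k) (D.Y0_subset k) (D.Y1_subset k)).2
    ⟨?_, ?_, ⟨?_, hk'⟩, ⟨?_, by omega⟩, ?_, ?_⟩
  · refine le_trans (le_of_eq ?_) (le_max_left _ _)
    rw [add_comm, add_comm π0, add_assoc]; rfl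
  · refine le_trans (le_of_eq ?_) (le_max_right _ _)
    rw [add_comm, add_comm π1, add_assoc]; rfl
  · refine disjoint_left.2 fun i hiX hiY => ?_
    exact not_lt.2 (mem_filter.1 (hYF hiY)).2 (mem_filter.1 (hXC hiX)).2.1
  · exact disjoint_of_subset_right hY1 disjoint_sdiff
  · exact fun i hi => (mem_filter.1 (hYF hi)).2
  · exact fun i hi => (mem_filter.1 (hXC hi)).2.2

theorem exists_valid_value_le {t : ℝ} {x y0 y1 : Fin n → ℝ}
    (h : SubFeasible (selection n p) lo hi π0 π1 t x y0 y1) :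
    ∃ k ≤ p, (ofVec p lo hi π0 π1).Valid k ∧ (ofVec p lo hi π0 π1).value k ≤ t := by
  set D := ofVec p lo hi π0 π1 with hD
  obtain ⟨X, hX, rfl⟩ := h.2.2.1.exists_eq_indicatorVec
  obtain ⟨Y0, hY0, rfl⟩ := h.2.2.2.1.1.exists_eq_indicatorVec
  obtain ⟨Y1, hY1, rfl⟩ := h.2.2.2.2.1.1.exists_eq_indicatorVec
  obtain ⟨ht0, ht1, ⟨hd0, hc0⟩, ⟨hd1, hc1⟩, hF, hC⟩ := (subFeasible_indicatorVec hX hY0 hY1).1 h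
  obtain ⟨k, hk, hvalid, h0, h1⟩ := exists_cheapest_le (w := D.w) (V := range n) (C := D.C)
    (F := D.F) D.C_subset (fun i hi => by
      by_cases hlt : π0 < D.v i - D.w i
      · exact mem_union_left _ (mem_filter.2 ⟨hX hi, hlt, hC i hi⟩)
      · exact mem_union_right _ (mem_filter.2 ⟨hX hi, not_lt.1 hlt⟩))
    (fun i hi => mem_filter.2 ⟨hY0 hi, hF i hi⟩) hX hY1 hd0 hd1 hc0 hc1
  refine ⟨k, hk, hvalid, max_le ?_ ?_⟩
  · exact le_trans (by linarith! [h0]) ht0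
  · exact le_trans (by linarith! [h1]) ht1

end SubData

/-! ### The program for the subproblems -/

/-- The memory holds the input of size `n` and the constants used by the programs: the natural
registers `0`, `1`, `2`, `3`, `4` hold `n`, `p`, `n + 1`, `1`, `0`, and the real arrays `0`, `1`
hold the cost bounds. -/
structure Loaded (n p : ℕ) (w v : ℕ → ℝ) (s : Memory) : Prop extends Ready n s where
  p_eq : s.nreg 1 = p
  succ : s.nreg 2 = n + 1
  lo_eq : s.rarr 0 = w
  hi_eq : s.rarr 1 = v

/-- The locations to which `Loaded` refers. -/
def inputLocs : List Loc :=
  [.nreg 0, .nreg 1, .nreg 2, .nreg 3, .nreg 4, .rarr 0, .rarr 1]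

theorem Loaded.of_same {n p : ℕ} {w v : ℕ → ℝ} {s s' : Memory} (h : Loaded n p w v s)
    (hs : ∀ l ∈ inputLocs, l.Same s s') : Loaded n p w v s' where
  n_eq := Eq.trans (hs (.nreg 0) (by decide) : s'.nreg 0 = s.nreg 0) h.n_eq
  p_eq := Eq.trans (hs (.nreg 1) (by decide) : s'.nreg 1 = s.nreg 1) h.p_eq
  succ := Eq.trans (hs (.nreg 2) (by decide) : s'.nreg 2 = s.nreg 2) h.succ
  one := Eq.trans (hs (.nreg 3) (by decide) : s'.nreg 3 = s.nreg 3) h.one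
  zero := Eq.trans (hs (.nreg 4) (by decide) : s'.nreg 4 = s.nreg 4) h.zero
  lo_eq := Eq.trans (hs (.rarr 0) (by decide) : s'.rarr 0 = s.rarr 0) h.lo_eq
  hi_eq := Eq.trans (hs (.rarr 1) (by decide) : s'.rarr 1 = s.rarr 1) h.hi_eq

theorem Loaded.den {n p : ℕ} {w v : ℕ → ℝ} {s : Memory} (h : Loaded n p w v s) {P : FProg}
    (hP : ∀ l ∈ inputLocs, l ∉ P.writes) : Loaded n p w v (P.den s) :=
  h.of_same fun l hl => FProg.same_den (hP l hl) s

namespace FProg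

/-- For `k` in the natural register `5`, write the first stage of the `k`-th candidate solution to
the natural array `6`, its size to the register `14` and its cost to the real register `5`. -/
def candidateX : FProg :=
  block [Instr.ncopy 10 5, selectCheapest 3 6, Instr.ncopy 14 13, Instr.rcopy 5 4]

/-- Write the second stage `y0` of the `k`-th candidate solution to the natural array `7`; add its
size to the register `14`, and write its part of the objective value to the real register `6`. -/
def candidateY0 : FProg :=
  block [complement 6 5, Instr.nsub 10 1 5, selectCheapest 4 7, Instr.nadd 14 14 13,
    Instr.radd 6 5 4, Instr.radd 6 6 0]

/-- Write the second stage `y1` of the `k`-th candidate solution to the natural array `8`, and the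
objective value to the real register `8`. -/
def candidateY1 : FProg :=
  block [selectCheapest 5 8, Instr.radd 7 5 4, Instr.radd 7 7 1,
    cond (.rlt 7 6) (Instr.rcopy 8 6) (Instr.rcopy 8 7)]

/-- Compute the `k`-th candidate solution and its objective value. -/
def candidate : FProg := block [candidateX, candidateY0, candidateY1]

/-- Store the current candidate solution as the best one: a flag in the natural register `11`, the
value in the real register `9`, the vectors in the natural arrays `0`, `1`, `2`. -/
def accept : FProg :=
  block [Instr.ncopy 11 3, Instr.rcopy 9 8, copyArray 6 0, copyArray 7 1, copyArray 8 2]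

/-- Accept the current candidate solution if it is feasible and better than the best one so far. -/
def update : FProg :=
  cond (.neq 14 1) (cond (.neq 11 4) accept (cond (.rlt 8 9) accept Instr.skip)) Instr.skip

/-- Find the best feasible candidate solution. -/
def solveSub : FProg :=
  block [markItems, Instr.nconst 11 0, rep 5 2 (block [candidate, update])]

theorem den_candidateX {n : ℕ} {s : Memory} (hr : Ready n s) {C : Finset ℕ}
    (hC : Encodes (s.narr 3) n C) :
    Encodes ((candidateX.den s).narr 6) n (cheapest (s.rarr 0) C (s.nreg 5)) ∧
    (candidateX.den s).nreg 14 = #(cheapest (s.rarr 0) C (s.nreg 5)) ∧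
    (candidateX.den s).rreg 5 = ∑ i ∈ cheapest (s.rarr 0) C (s.nreg 5), s.rarr 0 i := by
  obtain ⟨h1, h2, h3⟩ := den_selectCheapest (cand := 3) (out := 6) (by decide)
    (s := (Instr.ncopy 10 5).exec s) ⟨hr.n_eq, hr.one, hr.zero⟩ hC
  refine ⟨?_, ?_, ?_⟩
  · simpa [Instr.exec, candidateX] using h1
  · simpa [Instr.exec, candidateX] using h2
  · simpa [Instr.exec, candidateX] using h3

theorem den_candidateY0 {n : ℕ} {s : Memory} (hr : Ready n s) {X F : Finset ℕ}
    (hX : Encodes (s.narr 6) n X) (hF : Encodes (s.narr 4) n F) :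
    let s' := candidateY0.den s
    let Y := cheapest (s.rarr 0) F (s.nreg 1 - s.nreg 5)
    Encodes (s'.narr 5) n (range n \ X) ∧ Encodes (s'.narr 7) n Y ∧
      s'.nreg 10 = s.nreg 1 - s.nreg 5 ∧ s'.nreg 14 = s.nreg 14 + #Y ∧
      s'.rreg 6 = s.rreg 5 + ∑ i ∈ Y, s.rarr 0 i + s.rreg 0 := by
  set s1 := (complement 6 5).den s with hs1
  have h0 := den_complement (src := 6) (dst := 5) (by decide) hr hX
  have hr1 : Ready n s1 := hr.den (by decide)
  have e1 : s1.nreg 1 = s.nreg 1 := nreg_den _ (by decide) s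
  have e5 : s1.nreg 5 = s.nreg 5 := nreg_den _ (by decide) s
  have e14 : s1.nreg 14 = s.nreg 14 := nreg_den _ (by decide) s
  have ea0 : s1.rarr 0 = s.rarr 0 := rarr_den _ (by decide) s
  have ea4 : s1.narr 4 = s.narr 4 := narr_den _ (by decide) s
  have er5 : s1.rreg 5 = s.rreg 5 := rreg_den _ (by decide) s
  have er0 : s1.rreg 0 = s.rreg 0 := rreg_den _ (by decide) s
  set s2 := (Instr.nsub 10 1 5).exec s1 with hs2
  obtain ⟨h1, h2, h3⟩ := den_selectCheapest (cand := 4) (out := 7) (by decide) (s := s2)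
    ⟨hr1.n_eq, hr1.one, hr1.zero⟩ (S := F) (by simpa [hs2, Instr.exec, ea4] using hF)
  set s3 := (selectCheapest 4 7).den s2 with hs3
  have f10 : s3.nreg 10 = s2.nreg 10 := nreg_den _ (by decide) s2
  have f14 : s3.nreg 14 = s2.nreg 14 := nreg_den _ (by decide) s2
  have fr5 : s3.rreg 5 = s2.rreg 5 := rreg_den _ (by decide) s2
  have fr0 : s3.rreg 0 = s2.rreg 0 := rreg_den _ (by decide) s2
  have fa5 : s3.narr 5 = s2.narr 5 := narr_den _ (by decide) s2
  have g10 : s2.nreg 10 = s.nreg 1 - s.nreg 5 := by simp [hs2, Instr.exec, e1, e5]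
  have g : s2.rarr 0 = s.rarr 0 := ea0
  rw [g10, g] at h1 h2 h3
  have hden : candidateY0.den s = (Instr.radd 6 6 0).exec ((Instr.radd 6 5 4).exec
    ((Instr.nadd 14 14 13).exec s3)) := rfl
  intro s' Y
  refine ⟨?_, ?_, ?_, ?_, ?_⟩
  · simpa [s', hden, Instr.exec, fa5, hs2] using h0
  · simpa [s', hden, Instr.exec] using h1
  · simp [s', hden, Instr.exec, f10, g10]
  · simp [s', hden, Instr.exec, h2, f14, hs2, e14, Y]
  · simp [s', hden, Instr.exec, h3, fr5, fr0, hs2, er5, er0, Y]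

theorem den_candidateY1 {n : ℕ} {s : Memory} (hr : Ready n s) {S : Finset ℕ}
    (hS : Encodes (s.narr 5) n S) :
    let s' := candidateY1.den s
    let Y := cheapest (s.rarr 0) S (s.nreg 10)
    Encodes (s'.narr 8) n Y ∧
      s'.rreg 8 = max (s.rreg 6) (s.rreg 5 + ∑ i ∈ Y, s.rarr 0 i + s.rreg 1) := by
  obtain ⟨h1, -, h3⟩ := den_selectCheapest (cand := 5) (out := 8) (by decide) hr hS
  set s1 := (selectCheapest 5 8).den s with hs1
  have e5 : s1.rreg 5 = s.rreg 5 := rreg_den _ (by decide) s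
  have e6 : s1.rreg 6 = s.rreg 6 := rreg_den _ (by decide) s
  have e1 : s1.rreg 1 = s.rreg 1 := rreg_den _ (by decide) s
  intro s' Y
  have hden : s' = (cond (.rlt 7 6) (Instr.rcopy 8 6) (Instr.rcopy 8 7)).den
    ((Instr.radd 7 7 1).exec ((Instr.radd 7 5 4).exec s1)) := rfl
  rw [hden]
  by_cases h : s.rreg 5 + ∑ i ∈ Y, s.rarr 0 i + s.rreg 1 < s.rreg 6
  · refine ⟨?_, ?_⟩
    · simpa [den, Test.Holds, Instr.exec, h3, e5, e6, e1, h, Y] using h1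
    · simp [den, Test.Holds, Instr.exec, h3, e5, e6, e1, Y] at h ⊢
      simp [h, h.le]
  · refine ⟨?_, ?_⟩
    · simpa [den, Test.Holds, Instr.exec, h3, e5, e6, e1, h, Y] using h1
    · simp [den, Test.Holds, Instr.exec, h3, e5, e6, e1, Y] at h ⊢
      simp [not_lt.2 h, h]

end FProg

namespace SubData

variable (D : SubData)

/-- The memory holds the data of a subproblem and the sets of its items of either kind. -/
structure Holds (s : Memory) : Prop extends Loaded D.n D.p D.w D.v s where
  π0_eq : s.rreg 0 = D.π0
  π1_eq : s.rreg 1 = D.π1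
  C_eq : Encodes (s.narr 3) D.n D.C
  F_eq : Encodes (s.narr 4) D.n D.F

theorem den_candidate {s : Memory} (h : D.Holds s) :
    let s' := FProg.candidate.den s
    let k := s.nreg 5
    Encodes (s'.narr 6) D.n (D.X k) ∧ Encodes (s'.narr 7) D.n (D.Y0 k) ∧
      Encodes (s'.narr 8) D.n (D.Y1 k) ∧ s'.nreg 14 = #(D.X k) + #(D.Y0 k) ∧
      s'.rreg 8 = D.value k := by
  intro s' k
  obtain ⟨hX, hX14, hX5⟩ := FProg.den_candidateX h.toReady h.C_eq
  set s1 := FProg.candidateX.den s with hs1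
  have h1 : Loaded D.n D.p D.w D.v s1 := h.toLoaded.den (by decide)
  have hF : s1.narr 4 = s.narr 4 := FProg.narr_den _ (by decide) s
  have h5 : s1.nreg 5 = k := FProg.nreg_den _ (by decide) s
  have hπ0 : s1.rreg 0 = s.rreg 0 := FProg.rreg_den _ (by decide) s
  have hπ1 : s1.rreg 1 = s.rreg 1 := FProg.rreg_den _ (by decide) s
  rw [h.lo_eq] at hX hX14 hX5
  obtain ⟨hc, hY, h10, hY14, hY6⟩ := FProg.den_candidateY0 h1.toReady hX
    (by rw [hF]; exact h.F_eq)
  set s2 := FProg.candidateY0.den s1 with hs2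
  have h2 : Loaded D.n D.p D.w D.v s2 := h1.den (by decide)
  have g5 : s2.rreg 5 = s1.rreg 5 := FProg.rreg_den _ (by decide) s1
  have g1 : s2.rreg 1 = s1.rreg 1 := FProg.rreg_den _ (by decide) s1
  have g6 : s2.narr 6 = s1.narr 6 := FProg.narr_den _ (by decide) s1
  rw [h1.lo_eq, h1.p_eq, h5] at hY hY14 hY6
  rw [h1.p_eq, h5] at h10
  obtain ⟨hZ, hZ8⟩ := FProg.den_candidateY1 h2.toReady hc
  have hs' : s' = FProg.candidateY1.den s2 := rfl
  have k6 : s'.narr 6 = s2.narr 6 := by rw [hs']; exact FProg.narr_den _ (by decide) s2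
  have k7 : s'.narr 7 = s2.narr 7 := by rw [hs']; exact FProg.narr_den _ (by decide) s2
  have k14 : s'.nreg 14 = s2.nreg 14 := by rw [hs']; exact FProg.nreg_den _ (by decide) s2
  rw [h2.lo_eq, h10] at hZ hZ8
  refine ⟨?_, ?_, hZ, ?_, ?_⟩
  · rw [k6, g6]; exact hX
  · rw [k7]; exact hY
  · rw [k14, hY14, hX14]; rfl
  · rw [hs', hZ8, hY6, g5, g1, hX5, hπ0, hπ1, h.π0_eq, h.π1_eq]; rfl

/-- The best of the candidate solutions with `k < m` is stored, if there is a feasible one. -/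
def Best (m : ℕ) (s : Memory) : Prop :=
  (s.nreg 11 = 0 ∧ ∀ k < m, ¬ D.Valid k) ∨
  (s.nreg 11 = 1 ∧ ∃ k, D.Valid k ∧ (∀ j < m, D.Valid j → D.value k ≤ D.value j) ∧
    s.rreg 9 = D.value k ∧ Encodes (s.narr 0) D.n (D.X k) ∧ Encodes (s.narr 1) D.n (D.Y0 k) ∧
    Encodes (s.narr 2) D.n (D.Y1 k))

variable {D}

theorem Best.of_eq {m : ℕ} {s s' : Memory} (h : D.Best m s) (h11 : s'.nreg 11 = s.nreg 11)
    (h9 : s'.rreg 9 = s.rreg 9) (h0 : s'.narr 0 = s.narr 0) (h1 : s'.narr 1 = s.narr 1)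
    (h2 : s'.narr 2 = s.narr 2) : D.Best m s' := by
  unfold Best; rw [h11, h9, h0, h1, h2]; exact h

theorem best_accept {m : ℕ} {s : Memory} (hr : Ready D.n s) (hv : D.Valid m)
    (hX : Encodes (s.narr 6) D.n (D.X m)) (hY0 : Encodes (s.narr 7) D.n (D.Y0 m))
    (hY1 : Encodes (s.narr 8) D.n (D.Y1 m)) (h8 : s.rreg 8 = D.value m)
    (hle : ∀ j < m, D.Valid j → D.value m ≤ D.value j) :
    D.Best (m + 1) (FProg.accept.den s) := by
  set s1 := (Instr.rcopy 9 8).exec ((Instr.ncopy 11 3).exec s) with hs1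
  have hr1 : Ready D.n s1 := ⟨hr.n_eq, hr.one, hr.zero⟩
  set s2 := (FProg.copyArray 6 0).den s1 with hs2
  have hr2 : Ready D.n s2 := hr1.den (by decide)
  set s3 := (FProg.copyArray 7 1).den s2 with hs3
  have hr3 : Ready D.n s3 := hr2.den (by decide)
  have hden : FProg.accept.den s = (FProg.copyArray 8 2).den s3 := rfl
  have e7 : s2.narr 7 = s.narr 7 := FProg.narr_den _ (by decide) s1
  have e8 : s3.narr 8 = s.narr 8 :=
    (FProg.narr_den _ (by decide) s2).trans (FProg.narr_den _ (by decide) s1)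
  have c0 := FProg.den_copyArray (src := 6) (dst := 0) (by decide) hr1 hX
  have c1 := FProg.den_copyArray (src := 7) (dst := 1) (by decide) hr2 (e7 ▸ hY0)
  have c2 := FProg.den_copyArray (src := 8) (dst := 2) (by decide) hr3 (e8 ▸ hY1)
  have k0 : (FProg.accept.den s).narr 0 = s2.narr 0 :=
    (FProg.narr_den _ (by decide) s3).trans (FProg.narr_den _ (by decide) s2)
  have k1 : (FProg.accept.den s).narr 1 = s3.narr 1 := FProg.narr_den _ (by decide) s3
  have k11 : (FProg.accept.den s).nreg 11 = 1 :=
    (FProg.nreg_den 11 (P := .block [.copyArray 6 0, .copyArray 7 1, .copyArray 8 2])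
      (by decide) s1).trans (by simpa [hs1, Instr.exec] using hr.one)
  have k9 : (FProg.accept.den s).rreg 9 = D.value m :=
    (FProg.rreg_den 9 (P := .block [.copyArray 6 0, .copyArray 7 1, .copyArray 8 2])
      (by decide) s1).trans (by simpa [hs1, Instr.exec] using h8)
  refine Or.inr ⟨k11, m, hv, fun j hj hvj => ?_, k9, k0 ▸ c0, k1 ▸ c1, c2⟩
  rcases Nat.lt_succ_iff_lt_or_eq.1 hj with h | rfl
  · exact hle j h hvj
  · exact le_rfl

theorem best_update {m : ℕ} {s : Memory} (hl : Loaded D.n D.p D.w D.v s) (hb : D.Best m s)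
    (hX : Encodes (s.narr 6) D.n (D.X m)) (hY0 : Encodes (s.narr 7) D.n (D.Y0 m))
    (hY1 : Encodes (s.narr 8) D.n (D.Y1 m)) (h14 : s.nreg 14 = #(D.X m) + #(D.Y0 m))
    (h8 : s.rreg 8 = D.value m) : D.Best (m + 1) (FProg.update.den s) := by
  have hv : Test.Holds (.neq 14 1) s ↔ D.Valid m := by
    rw [Test.Holds, h14, hl.p_eq]; rfl
  have hzero : Test.Holds (.neq 11 4) s ↔ s.nreg 11 = 0 := by rw [Test.Holds, hl.zero]
  by_cases hvm : D.Valid m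
  · rw [FProg.update, FProg.den_cond_pos (hv.2 hvm)]
    rcases hb with ⟨hf, hb⟩ | ⟨hf, k, hvk, hk, h9, hrest⟩
    · rw [FProg.den_cond_pos (hzero.2 hf)]
      exact best_accept hl.toReady hvm hX hY0 hY1 h8 fun j hj hvj => absurd hvj (hb j hj)
    · rw [FProg.den_cond_neg (by rw [hzero, hf]; exact one_ne_zero)]
      by_cases hlt : D.value m < D.value k
      · rw [FProg.den_cond_pos (by rw [Test.Holds, h8, h9]; exact hlt)]
        exact best_accept hl.toReady hvm hX hY0 hY1 h8 fun j hj hvj =>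
          hlt.le.trans (hk j hj hvj)
      · rw [FProg.den_cond_neg (by rw [Test.Holds, h8, h9]; exact hlt)]
        refine Or.inr ⟨hf, k, hvk, fun j hj hvj => ?_, h9, hrest⟩
        rcases Nat.lt_succ_iff_lt_or_eq.1 hj with h | rfl
        · exact hk j h hvj
        · exact not_lt.1 hlt
  · rw [FProg.update, FProg.den_cond_neg (mt hv.1 hvm)]
    have hnext : ∀ j < m + 1, D.Valid j → j < m := fun j hj hvj => by
      rcases Nat.lt_succ_iff_lt_or_eq.1 hj with h | rfl
      · exact h
      · exact absurd hvj hvm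
    rcases hb with ⟨hf, hb⟩ | ⟨hf, k, hvk, hk, hrest⟩
    · exact Or.inl ⟨hf, fun j hj hvj => hb j (hnext j hj hvj) hvj⟩
    · exact Or.inr ⟨hf, k, hvk, fun j hj hvj => hk j (hnext j hj hvj) hvj, hrest⟩

theorem best_solveSub {s : Memory} (hl : Loaded D.n D.p D.w D.v s) (h0 : s.rreg 0 = D.π0)
    (h1 : s.rreg 1 = D.π1) : D.Best (D.n + 1) (FProg.solveSub.den s) := by
  obtain ⟨hF, hC⟩ := FProg.den_markItems hl.toReady
  rw [hl.lo_eq, hl.hi_eq, h0] at hF hC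
  rw [h1] at hC
  set s1 := (Instr.nconst 11 0).exec (FProg.markItems.den s) with hs1
  have hl1 : Loaded D.n D.p D.w D.v s1 :=
    (hl.den (P := .markItems) (by decide)).den (P := .instr (.nconst 11 0)) (by decide)
  have hH : D.Holds s1 :=
    { hl1 with
      π0_eq := (FProg.rreg_den 0 (P := .markItems) (by decide) s).trans h0
      π1_eq := (FProg.rreg_den 1 (P := .markItems) (by decide) s).trans h1
      C_eq := hC
      F_eq := hF }
  rw [← hl1.succ]
  refine FProg.den_rep_induct (i := 5) (lim := 2) (s := s1)
    (P := .block [.candidate, .update]) (I := D.Best) (by decide) (by decide)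
    (Or.inl ⟨by simp [hs1, Instr.exec], by simp⟩) ?_
  intro m s2 hm h5 hsame hb
  have hl2 : Loaded D.n D.p D.w D.v s2 :=
    hl1.of_same fun l hl => hsame l (by revert l; decide)
  have hH2 : D.Holds s2 :=
    { hl2 with
      π0_eq := Eq.trans (hsame (.rreg 0) (by decide) : s2.rreg 0 = s1.rreg 0) hH.π0_eq
      π1_eq := Eq.trans (hsame (.rreg 1) (by decide) : s2.rreg 1 = s1.rreg 1) hH.π1_eq
      C_eq := (hsame (.narr 3) (by decide) : s2.narr 3 = s1.narr 3) ▸ hH.C_eq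
      F_eq := (hsame (.narr 4) (by decide) : s2.narr 4 = s1.narr 4) ▸ hH.F_eq }
  obtain ⟨c6, c7, c8, c14, cr8⟩ := D.den_candidate hH2
  rw [h5] at c6 c7 c8 c14 cr8
  have hb3 : D.Best m (FProg.candidate.den s2) :=
    hb.of_eq (FProg.nreg_den _ (by decide) _) (FProg.rreg_den _ (by decide) _)
      (FProg.narr_den _ (by decide) _) (FProg.narr_den _ (by decide) _)
      (FProg.narr_den _ (by decide) _)
  exact (best_update (hl2.den (by decide)) hb3 c6 c7 c8 c14 cr8).of_eq
    (advance_nreg_of_ne (by decide) (by decide) _) rfl rfl rfl rfl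

end SubData

/-- The result of the program for a subproblem, with the flag in the natural register `11` and the
optimal value in the real register `9`. -/
theorem solveSub_spec {n p : ℕ} {lo hi : Fin n → ℝ} {π0 π1 : ℝ} (hp : p ≤ n) {s : Memory}
    (hl : Loaded n p (toArray lo) (toArray hi) s) (h0 : s.rreg 0 = π0) (h1 : s.rreg 1 = π1) :
    let s' := FProg.solveSub.den s
    (s'.nreg 11 = 1 ∧
      (∃ X Y0 Y1, Encodes (s'.narr 0) n X ∧ Encodes (s'.narr 1) n Y0 ∧ Encodes (s'.narr 2) n Y1 ∧
        SubFeasible (selection n p) lo hi π0 π1 (s'.rreg 9) (indicatorVec n X)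
          (indicatorVec n Y0) (indicatorVec n Y1)) ∧
      ∀ t x y0 y1, SubFeasible (selection n p) lo hi π0 π1 t x y0 y1 → s'.rreg 9 ≤ t) ∨
    (s'.nreg 11 = 0 ∧ ∀ t x y0 y1, ¬ SubFeasible (selection n p) lo hi π0 π1 t x y0 y1) := by
  intro s'
  rcases SubData.best_solveSub (D := .ofVec p lo hi π0 π1) hl h0 h1 with
    ⟨hf, hb⟩ | ⟨hf, k, hvk, hk, h9, hX, hY0, hY1⟩
  · refine Or.inr ⟨hf, fun t x y0 y1 h => ?_⟩
    obtain ⟨k, hkp, hv, -⟩ := SubData.exists_valid_value_le h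
    exact hb k (Nat.lt_succ_of_le (hkp.trans hp)) hv
  · refine Or.inl ⟨hf, ⟨_, _, _, hX, hY0, hY1, ?_⟩, fun t x y0 y1 h => ?_⟩
    · rw [h9]; exact SubData.Valid.subFeasible hp hvk
    · obtain ⟨j, hjp, hv, hjt⟩ := SubData.exists_valid_value_le h
      rw [h9]
      exact (hk j (Nat.lt_succ_of_le (hjp.trans hp)) hv).trans hjt

/-! ### The program for the robust problem -/

namespace FProg

/-- Write the deviations of the items in the natural registers `20` and `21` to the real registers
`0` and `1`. Beyond their length the cost arrays hold zeros, so index `n` yields the value `0`. -/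
def loadDeviations : FProg :=
  block [Instr.rload 2 0 20, Instr.rload 3 1 20, Instr.rsub 0 3 2,
    Instr.rload 2 0 21, Instr.rload 3 1 21, Instr.rsub 1 3 2]

/-- Store the solution of the current subproblem as the best one: a flag in the natural register
`22`, the value in the real register `20`, the first-stage solution in the natural array `9`. -/
def robAccept : FProg := block [Instr.ncopy 22 3, Instr.rcopy 20 9, copyArray 0 9]

/-- Accept the solution of the current subproblem if there is one and it is better than the best
one so far. -/
def robUpdate : FProg :=
  cond (.neq 11 4) Instr.skip
    (cond (.neq 22 4) robAccept (cond (.rlt 9 20) robAccept Instr.skip))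

/-- Solve the subproblem for a pair of items, and keep the best solution. -/
def robStep : FProg := block [loadDeviations, solveSub, robUpdate]

/-- Solve all subproblems, and move the best solution to the output locations. -/
def solveRob : FProg :=
  block [rep 20 2 (rep 21 2 robStep), copyArray 9 0, Instr.rcopy 0 20]

end FProg

section Rob

variable {n p : ℕ} {lo hi : Fin n → ℝ}

/-- The best solution of the subproblems with parameters in `Q` is stored, if there is a feasible
one. -/
def RobBest (p : ℕ) (lo hi : Fin n → ℝ) (Q : Set (ℝ × ℝ)) (s : Memory) : Prop :=
  (s.nreg 22 = 0 ∧ ∀ q ∈ Q, ∀ t x y0 y1,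
    ¬ SubFeasible (selection n p) lo hi q.1 q.2 t x y0 y1) ∨
  (s.nreg 22 = 1 ∧
    (∃ S, Encodes (s.narr 9) n S ∧ ∃ q ∈ Q, ∃ y0 y1,
      SubFeasible (selection n p) lo hi q.1 q.2 (s.rreg 20) (indicatorVec n S) y0 y1) ∧
    ∀ q ∈ Q, ∀ t x y0 y1, SubFeasible (selection n p) lo hi q.1 q.2 t x y0 y1 → s.rreg 20 ≤ t)

theorem RobBest.of_eq {Q : Set (ℝ × ℝ)} {s s' : Memory} (h : RobBest p lo hi Q s)
    (h22 : s'.nreg 22 = s.nreg 22) (h20 : s'.rreg 20 = s.rreg 20) (h9 : s'.narr 9 = s.narr 9) :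
    RobBest p lo hi Q s' := by
  unfold RobBest; rw [h22, h20, h9]; exact h

theorem den_robAccept {s : Memory} (hr : Ready n s) {S : Finset ℕ}
    (hS : Encodes (s.narr 0) n S) :
    (FProg.robAccept.den s).nreg 22 = 1 ∧ (FProg.robAccept.den s).rreg 20 = s.rreg 9 ∧
      Encodes ((FProg.robAccept.den s).narr 9) n S := by
  set s1 := (Instr.rcopy 20 9).exec ((Instr.ncopy 22 3).exec s) with hs1
  have hr1 : Ready n s1 := ⟨hr.n_eq, hr.one, hr.zero⟩
  have hden : FProg.robAccept.den s = (FProg.copyArray 0 9).den s1 := rfl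
  rw [hden]
  refine ⟨?_, ?_, FProg.den_copyArray (by decide) hr1 hS⟩
  · rw [FProg.nreg_den _ (by decide)]
    simpa [hs1, Instr.exec] using hr.one
  · rw [FProg.rreg_den _ (by decide)]
    simp [hs1, Instr.exec]

theorem robBest_update {s : Memory} {Q : Set (ℝ × ℝ)} {π0 π1 : ℝ} (hr : Ready n s)
    (hb : RobBest p lo hi Q s)
    (h : (s.nreg 11 = 1 ∧ (∃ S, Encodes (s.narr 0) n S ∧ ∃ y0 y1,
        SubFeasible (selection n p) lo hi π0 π1 (s.rreg 9) (indicatorVec n S) y0 y1) ∧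
        ∀ t x y0 y1, SubFeasible (selection n p) lo hi π0 π1 t x y0 y1 → s.rreg 9 ≤ t) ∨
      (s.nreg 11 = 0 ∧ ∀ t x y0 y1, ¬ SubFeasible (selection n p) lo hi π0 π1 t x y0 y1)) :
    RobBest p lo hi (insert (π0, π1) Q) (FProg.robUpdate.den s) := by
  have hz : ∀ r, Test.Holds (.neq r 4) s ↔ s.nreg r = 0 := fun r => by rw [Test.Holds, hr.zero]
  rcases h with ⟨hf, ⟨S, hS, y0, y1, hfeas⟩, hopt⟩ | ⟨hf, hinf⟩
  · rw [FProg.robUpdate, FProg.den_cond_neg (by rw [hz, hf]; exact one_ne_zero)]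
    -- accepting is right if the new value is a lower bound for the old subproblems
    have hacc : (∀ q ∈ Q, ∀ t x y0 y1,
        SubFeasible (selection n p) lo hi q.1 q.2 t x y0 y1 → s.rreg 9 ≤ t) →
        RobBest p lo hi (insert (π0, π1) Q) (FProg.robAccept.den s) := by
      intro hQ
      obtain ⟨h22, h20, h9⟩ := den_robAccept hr hS
      refine Or.inr ⟨h22, ⟨S, h9, (π0, π1), Set.mem_insert _ _, y0, y1, ?_⟩, ?_⟩
      · rw [h20]; exact hfeas
      · rw [h20]
        rintro q (rfl | hq)
        · exact hopt
        · exact hQ q hq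
    rcases hb with ⟨h22, hQ⟩ | ⟨h22, ⟨S', hS', q', hq', hfeas'⟩, hQ⟩
    · rw [FProg.den_cond_pos ((hz 22).2 h22)]
      exact hacc fun q hq t x y0 y1 hsub => absurd hsub (hQ q hq t x y0 y1)
    · rw [FProg.den_cond_neg (by rw [hz, h22]; exact one_ne_zero)]
      by_cases hlt : s.rreg 9 < s.rreg 20
      · rw [FProg.den_cond_pos (b := .rlt 9 20) hlt]
        exact hacc fun q hq t x y0 y1 hsub => hlt.le.trans (hQ q hq t x y0 y1 hsub)
      · rw [FProg.den_cond_neg (b := .rlt 9 20) hlt]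
        refine Or.inr ⟨h22, ⟨S', hS', q', Set.mem_insert_of_mem _ hq', hfeas'⟩, ?_⟩
        rintro q (rfl | hq) t x y0 y1 hsub
        · exact (not_lt.1 hlt).trans (hopt t x y0 y1 hsub)
        · exact hQ q hq t x y0 y1 hsub
  · rw [FProg.robUpdate, FProg.den_cond_pos ((hz 11).2 hf)]
    rcases hb with ⟨h22, hQ⟩ | ⟨h22, ⟨S', hS', q', hq', hfeas'⟩, hQ⟩
    · refine Or.inl ⟨h22, ?_⟩
      rintro q (rfl | hq)
      · exact hinf
      · exact hQ q hq
    · refine Or.inr ⟨h22, ⟨S', hS', q', Set.mem_insert_of_mem _ hq', hfeas'⟩, ?_⟩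
      rintro q (rfl | hq) t x y0 y1 hsub
      · exact absurd hsub (hinf t x y0 y1)
      · exact hQ q hq t x y0 y1 hsub

/-- The deviation of item `i`; it is zero for `i ≥ n`. -/
def deviation (lo hi : Fin n → ℝ) (i : ℕ) : ℝ := toArray hi i - toArray lo i

theorem mem_deviations_iff {π : ℝ} :
    π ∈ deviations lo hi ↔ ∃ i < n + 1, deviation lo hi i = π := by
  simp only [deviations, mem_insert, mem_image, mem_univ, true_and]
  constructor
  · rintro (rfl | ⟨i, rfl⟩)
    · exact ⟨n, by omega, by simp [deviation, toArray]⟩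
    · exact ⟨i, by omega, by simp [deviation, toArray]⟩
  · rintro ⟨i, hi', rfl⟩
    by_cases hin : i < n
    · exact Or.inr ⟨⟨i, hin⟩, by simp [deviation, toArray, hin]⟩
    · exact Or.inl (by simp [deviation, toArray, hin])

theorem robBest_step (hp : p ≤ n) {s : Memory} {Q : Set (ℝ × ℝ)}
    (hl : Loaded n p (toArray lo) (toArray hi) s) (hb : RobBest p lo hi Q s) :
    RobBest p lo hi (insert (deviation lo hi (s.nreg 20), deviation lo hi (s.nreg 21)) Q)
      (FProg.robStep.den s) := by
  have hl1 : Loaded n p (toArray lo) (toArray hi) (FProg.loadDeviations.den s) :=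
    hl.den (by decide)
  have h0 : (FProg.loadDeviations.den s).rreg 0 = deviation lo hi (s.nreg 20) := by
    simp [FProg.loadDeviations, Instr.exec, deviation, hl.lo_eq, hl.hi_eq]
  have h1 : (FProg.loadDeviations.den s).rreg 1 = deviation lo hi (s.nreg 21) := by
    simp [FProg.loadDeviations, Instr.exec, deviation, hl.lo_eq, hl.hi_eq]
  have hb1 : RobBest p lo hi Q (FProg.loadDeviations.den s) :=
    hb.of_eq (FProg.nreg_den _ (by decide) _) (FProg.rreg_den _ (by decide) _)
      (FProg.narr_den _ (by decide) _)
  have hden : FProg.robStep.den s =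
    FProg.robUpdate.den (FProg.solveSub.den (FProg.loadDeviations.den s)) := rfl
  rw [hden]
  generalize FProg.loadDeviations.den s = s1 at hl1 h0 h1 hb1
  have hl2 : Loaded n p (toArray lo) (toArray hi) (FProg.solveSub.den s1) := hl1.den (by decide)
  have hb2 : RobBest p lo hi Q (FProg.solveSub.den s1) :=
    hb1.of_eq (FProg.nreg_den _ (by decide) _) (FProg.rreg_den _ (by decide) _)
      (FProg.narr_den _ (by decide) _)
  refine robBest_update hl2.toReady hb2 ?_
  rcases solveSub_spec hp hl1 h0 h1 with
    ⟨hf, ⟨S, _, _, hS, -, -, hfeas⟩, hopt⟩ | h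
  · exact Or.inl ⟨hf, ⟨S, hS, _, _, hfeas⟩, hopt⟩
  · exact Or.inr h

theorem robBest_loops (hp : p ≤ n) {s : Memory}
    (hl : Loaded n p (toArray lo) (toArray hi) s) (h22 : s.nreg 22 = 0) :
    RobBest p lo hi (deviations lo hi ×ˢ deviations lo hi : Finset (ℝ × ℝ))
      ((FProg.rep 20 2 (.rep 21 2 .robStep)).den s) := by
  -- the pairs treated before the inner loop reaches the pair `(a, b)`
  let Q : ℕ → ℕ → Set (ℝ × ℝ) := fun a b =>
    {q | ∃ i j, (i < a ∧ j < n + 1 ∨ i = a ∧ j < b) ∧ (deviation lo hi i, deviation lo hi j) = q}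
  have hQ0 : Q 0 0 = ∅ := by
    ext q; simp [Q]
  have hQsucc : ∀ a b, Q a (b + 1) = insert (deviation lo hi a, deviation lo hi b) (Q a b) := by
    intro a b; ext q; constructor
    · rintro ⟨i, j, h, rfl⟩
      by_cases hab : i = a ∧ j = b
      · rw [hab.1, hab.2]; exact Set.mem_insert _ _
      · exact Set.mem_insert_of_mem _ ⟨i, j, by omega, rfl⟩
    · rintro (rfl | ⟨i, j, h, rfl⟩)
      · exact ⟨a, b, by omega, rfl⟩
      · exact ⟨i, j, by omega, rfl⟩
  have hQnext : ∀ a, Q a (n + 1) = Q (a + 1) 0 := by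
    intro a; ext q; constructor <;>
    · rintro ⟨i, j, h, rfl⟩
      exact ⟨i, j, by omega, rfl⟩
  have hQend : (deviations lo hi ×ˢ deviations lo hi : Finset (ℝ × ℝ)) = Q (n + 1) 0 := by
    ext ⟨π0, π1⟩
    simp only [mem_coe, mem_product, mem_deviations_iff]
    constructor
    · rintro ⟨⟨i, hi', rfl⟩, ⟨j, hj, rfl⟩⟩
      exact ⟨i, j, Or.inl ⟨hi', hj⟩, rfl⟩
    · rintro ⟨i, j, h, he⟩
      rw [Prod.mk.injEq] at he
      exact ⟨⟨i, by omega, he.1⟩, ⟨j, by omega, he.2⟩⟩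
  rw [hQend, ← hl.succ]
  refine FProg.den_rep_induct (i := 20) (lim := 2) (s := s) (P := .rep 21 2 .robStep)
    (I := fun a s' => RobBest p lo hi (Q a 0) s') (by decide) (by decide)
    (by rw [hQ0]; exact Or.inl ⟨by simpa [Instr.exec] using h22, by simp⟩) ?_
  intro a s1 _ h20 hsame hb
  have hl1 : Loaded n p (toArray lo) (toArray hi) s1 :=
    hl.of_same fun l hl => hsame l (by revert l; decide)
  refine RobBest.of_eq ?_ (advance_nreg_of_ne (by decide) (by decide) _) rfl rfl
  rw [← hQnext, ← hl1.succ]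
  refine FProg.den_rep_induct (i := 21) (lim := 2) (s := s1) (P := .robStep)
    (I := fun b s' => RobBest p lo hi (Q a b) s') (by decide) (by decide)
    (hb.of_eq (by simp [Instr.exec]) rfl rfl) ?_
  intro b s2 _ h21 hsame2 hb2
  have hl2 : Loaded n p (toArray lo) (toArray hi) s2 :=
    hl1.of_same fun l hl => hsame2 l (by revert l; decide)
  have h20' : s2.nreg 20 = a :=
    Eq.trans (hsame2 (.nreg 20) (by decide) : s2.nreg 20 = s1.nreg 20) h20
  have := robBest_step hp hl2 hb2
  rw [h20', h21, ← hQsucc] at this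
  exact this.of_eq (advance_nreg_of_ne (by decide) (by decide) _) rfl rfl

/-- Some subproblem is feasible: select `p` items in the second stage and none in the first. -/
theorem exists_subFeasible (hp : p ≤ n) (hlo : ∀ i, 0 ≤ lo i ∧ lo i ≤ hi i) :
    ∃ q ∈ deviations lo hi ×ˢ deviations lo hi, ∃ t x y0 y1,
      SubFeasible (selection n p) lo hi q.1 q.2 t x y0 y1 := by
  have hsub : range p ⊆ range n := range_subset_range.2 hp
  have hmem : indicatorVec n (range p) ∈ secondStage (selection n p) (indicatorVec n ∅) :=
    (indicatorVec_mem_secondStage (empty_subset _) hsub).2 (by simp)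
  obtain ⟨π0, h0, π1, h1, t, y0, y1, h, -⟩ :=
    exists_subFeasible_le_adv hlo (isBinary_indicatorVec ∅) ⟨_, hmem⟩
  exact ⟨(π0, π1), mk_mem_product h0 h1, t, _, y0, y1, h⟩

theorem solvesRob_solveRob (hp : p ≤ n) (hlo : ∀ i, 0 ≤ lo i ∧ lo i ≤ hi i) {s : Memory}
    (hl : Loaded n p (toArray lo) (toArray hi) s) (h22 : s.nreg 22 = 0) :
    SolvesRob p lo hi (FProg.solveRob.den s) := by
  have hb := robBest_loops hp hl h22
  have hr1 : Ready n ((FProg.rep 20 2 (.rep 21 2 .robStep)).den s) := hl.toReady.den (by decide)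
  have hden : FProg.solveRob.den s = (Instr.rcopy 0 20).exec ((FProg.copyArray 9 0).den
    ((FProg.rep 20 2 (.rep 21 2 .robStep)).den s)) := rfl
  rw [hden]
  generalize (FProg.rep 20 2 (.rep 21 2 .robStep)).den s = s1 at hb hr1
  obtain ⟨q', hq', t', x', y0', y1', hfeas'⟩ := exists_subFeasible hp hlo
  rcases hb with ⟨-, hQ⟩ | ⟨-, ⟨S, hS, q, hq, y0, y1, hfeas⟩, hQ⟩
  · exact absurd hfeas' (hQ q' (mem_coe.2 hq') t' x' y0' y1')
  · rw [mem_coe, mem_product] at hq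
    have hadv := adv_le_of_subFeasible hlo (nonneg_of_mem_deviations hlo hq.1)
      (nonneg_of_mem_deviations hlo hq.2) hfeas
    have hle : (s1.rreg 20 : EReal) ≤ rob (selection n p) lo hi lo hi 1 := by
      rw [rob_eq_iInf_subValue hlo]
      refine le_iInf₂ fun q hq => le_iInf₂ fun t ht => ?_
      obtain ⟨x, y0, y1, h⟩ := ht
      exact EReal.coe_le_coe_iff.2 (hQ q (mem_coe.2 hq) t x y0 y1 h)
    have hrob : rob (selection n p) lo hi lo hi 1 ≤
        adv (selection n p) lo hi lo hi 1 (indicatorVec n S) :=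
      iInf₂_le _ (isBinary_indicatorVec S)
    set s2 := (Instr.rcopy 0 20).exec ((FProg.copyArray 9 0).den s1) with hs2
    have hout : output s2 n 0 = indicatorVec n S :=
      (FProg.den_copyArray (by decide) hr1 hS).output_eq (s := s2)
    have hval : s2.rreg 0 = s1.rreg 20 := by
      have := FProg.rreg_den (P := .copyArray 9 0) 20 (by decide) s1
      simpa [hs2, Instr.exec] using this
    rw [SolvesRob, hout, hval]
    exact ⟨isBinary_indicatorVec S, le_antisymm (hadv.trans hle) hrob,
      le_antisymm (hrob.trans hadv) hle⟩

end Rob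

/-! ### Complete programs and their running time -/

/-- Memory after the initialisation of the constants. -/
noncomputable def prepared {n : ℕ} (p : ℕ) (lo hi : Fin n → ℝ) (r0 r1 : ℝ) : Memory :=
  (Instr.nadd 2 0 3).exec ((Instr.nconst 3 1).exec (input p lo hi r0 r1))

theorem loaded_prepared {n : ℕ} (p : ℕ) (lo hi : Fin n → ℝ) (r0 r1 : ℝ) :
    Loaded n p (toArray lo) (toArray hi) (prepared p lo hi r0 r1) := by
  constructor
  · constructor <;> simp [prepared, input, Instr.exec]
  all_goals simp [prepared, input, Instr.exec]

/-- Initialise the constants, and run a structured program. -/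
def withConstants (P : FProg) : Program :=
  .seq (.instr (.nconst 3 1)) (.seq (.instr (.nadd 2 0 3)) P.compile)

theorem exists_runs_withConstants {P : FProg} (hP : P.wf [0, 2]) {n : ℕ} (hn : 1 ≤ n) (p : ℕ)
    (lo hi : Fin n → ℝ) (r0 r1 : ℝ) :
    ∃ k, (withConstants P).Runs (input p lo hi r0 r1) k (P.den (prepared p lo hi r0 r1)) ∧
      k ≤ (P.size * 2 ^ P.depth + 2) * n ^ P.depth := by
  have hl := loaded_prepared p lo hi r0 r1
  obtain ⟨k, hk, hle⟩ := FProg.exists_runs hP (M := 2 * n) (by omega)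
    (s := prepared p lo hi r0 r1) (by simp [hl.n_eq, hl.succ]; omega)
  refine ⟨1 + (1 + k), .seq (.instr _ _) (.seq (.instr _ _) hk), ?_⟩
  have h1 : 1 ≤ n ^ P.depth := Nat.one_le_pow _ _ hn
  rw [mul_pow, ← mul_assoc] at hle
  rw [add_mul]
  omega

/-- Solve the subproblem, and move the flag and the value to the output locations. -/
def subProgram : Program :=
  .seq (withConstants .solveSub) (.seq (.instr (.ncopy 0 11)) (.instr (.rcopy 0 9)))

theorem exists_runs_subProgram {n p : ℕ} {lo hi : Fin n → ℝ} {π0 π1 : ℝ} (hn : 1 ≤ n)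
    (hp : p ≤ n) :
    ∃ k s, subProgram.Runs (input p lo hi π0 π1) k s ∧
      k ≤ (FProg.solveSub.size * 2 ^ 3 + 4) * n ^ 3 ∧ SolvesSub p lo hi π0 π1 s := by
  obtain ⟨k, hk, hle⟩ := exists_runs_withConstants (P := .solveSub) (by decide) hn p lo hi π0 π1
  have hspec := solveSub_spec (π0 := π0) (π1 := π1) hp (loaded_prepared p lo hi π0 π1)
    (by simp [prepared, input, Instr.exec]) (by simp [prepared, input, Instr.exec])
  generalize FProg.solveSub.den (prepared p lo hi π0 π1) = s at hk hspec
  refine ⟨_, _, .seq hk (.seq (.instr _ _) (.instr _ _)), ?_, ?_⟩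
  · have hd : FProg.solveSub.depth = 3 := by decide
    have h1 : 1 ≤ n ^ 3 := Nat.one_le_pow _ _ hn
    rw [hd, add_mul] at hle
    rw [add_mul]
    omega
  · rcases hspec with ⟨hf, ⟨X, Y0, Y1, hX, hY0, hY1, hfeas⟩, hopt⟩ | ⟨hf, hinf⟩
    · rw [← hX.output_eq, ← hY0.output_eq, ← hY1.output_eq] at hfeas
      exact Or.inl ⟨by simpa [Instr.exec] using hf,
        by simp only [Instr.exec, Function.update_self]; exact hfeas,
        by simpa [Instr.exec] using hopt⟩
    · exact Or.inr ⟨by simpa [Instr.exec] using hf, hinf⟩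

theorem exists_runs_solveRob {n p : ℕ} {lo hi : Fin n → ℝ} (hn : 1 ≤ n) (hp : p ≤ n)
    (hlo : ∀ i, 0 ≤ lo i ∧ lo i ≤ hi i) :
    ∃ k s, (withConstants .solveRob).Runs (input p lo hi 0 0) k s ∧
      k ≤ (FProg.solveRob.size * 2 ^ 5 + 2) * n ^ 5 ∧ SolvesRob p lo hi s := by
  obtain ⟨k, hk, hle⟩ := exists_runs_withConstants (P := .solveRob) (by decide) hn p lo hi 0 0
  have hd : FProg.solveRob.depth = 5 := by decide
  rw [hd] at hle
  exact ⟨k, _, hk, hle, solvesRob_solveRob hp hlo (loaded_prepared p lo hi 0 0)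
    (by simp [prepared, input, Instr.exec])⟩

end TwoStage

open TwoStage
theorem mainTheorem9 :
    -- the robust problem is solved in `O(n⁵)` steps
    (∃ (P : Program) (C : ℕ), ∀ (n p : ℕ) (lo hi : Fin n → ℝ), 1 ≤ n → p ≤ n →
      (∀ i, 0 ≤ lo i ∧ lo i ≤ hi i) →
      ∃ (k : ℕ) (s : Memory), P.Runs (input p lo hi 0 0) k s ∧ k ≤ C * n ^ 5 ∧
        SolvesRob p lo hi s) ∧
    -- it decomposes into `O(n²)` subproblems
    (∃ C : ℕ, ∀ (n p : ℕ) (lo hi : Fin n → ℝ), 1 ≤ n → p ≤ n →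
      (∀ i, 0 ≤ lo i ∧ lo i ≤ hi i) →
      (deviations lo hi ×ˢ deviations lo hi).card ≤ C * n ^ 2 ∧
      rob (selection n p) lo hi lo hi 1 =
        ⨅ q ∈ deviations lo hi ×ˢ deviations lo hi,
          subValue (selection n p) lo hi q.1 q.2) ∧
    -- each subproblem is solved in `O(n³)` steps
    (∃ (P : Program) (C : ℕ), ∀ (n p : ℕ) (lo hi : Fin n → ℝ) (π0 π1 : ℝ), 1 ≤ n → p ≤ n →
      (∀ i, 0 ≤ lo i ∧ lo i ≤ hi i) → 0 ≤ π0 → 0 ≤ π1 →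
      ∃ (k : ℕ) (s : Memory), P.Runs (input p lo hi π0 π1) k s ∧ k ≤ C * n ^ 3 ∧
        SolvesSub p lo hi π0 π1 s) := by
  refine ⟨⟨_, _, fun n p lo hi hn hp hlo => exists_runs_solveRob hn hp hlo⟩,
    ⟨4, fun n p lo hi hn hp hlo => ⟨?_, rob_eq_iInf_subValue hlo⟩⟩,
    ⟨_, _, fun n p lo hi π0 π1 hn hp _ _ _ => exists_runs_subProgram hn hp⟩⟩
  have h : (deviations lo hi).card ≤ 2 * n := card_deviations_le.trans (by omega)
  calc (deviations lo hi ×ˢ deviations lo hi).card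
      = (deviations lo hi).card * (deviations lo hi).card := Finset.card_product _ _
    _ ≤ 2 * n * (2 * n) := Nat.mul_le_mul h h
    _ = 4 * n ^ 2 := by ring
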